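/- Let $P\subset\mathbb R^2=\mathbb C$ be the closed polygon that is the union of the upper rectangle $[0,1]\times[\tfrac12,1]$ and the lower rectangle $[-\tfrac12,\tfrac12]\times[0,\tfrac12]$ (the segment $(0,\tfrac12)\times\{\tfrac12\}$ is interior to $P$). Cut the boundary of $P$ into the following open edges, where $n\ge 1$ and each of $A_n,B_n,C'_n,C''_n$ has length $1/2^{n+1}$ and occurs twice, and identify the two copies of each edge by a translation. * $A_n$: one copy is $\{1\}\times(1-2^{-n},\,1-2^{-n-1})$ on the right side of the upper rectangle. The other copy lies at height lower by $s_n$, on $\{0\}\times[\tfrac12,\tfrac23]$ if $n$ is even and on $\{-\tfrac12\}\times[0,\tfrac13]$ if $n$ is odd, where $s_n=(1-2^{-n})/3$ for $n$ even and $s_n=(2-2^{-n})/3$ for $n$ odd. * $B_n$: one copy is $\{\tfrac12\}\times(2^{-n-1},\,2^{-n})$ on the right side of the lower rectangle. The other copy lies at height greater by $s_n$, on $\{-\tfrac12\}\times[\tfrac13,\tfrac12]$ if $n$ is even and on $\{0\}\times[\tfrac23,1]$ if $n$ is odd. * $C'_n$, $C''_n$: the top side $[0,1]\times\{1\}$ is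 cut, from left to right, into $C'_1,C''_1,C'_2,C''_2,\dots$, and the bottom side $[-\tfrac12,\tfrac12]\times\{0\}$ is cut, from left to right, into $C''_1,C'_1,C''_2,C'_2,\dots$. * The remaining edges $(-\tfrac12,0)\times\{\tfrac12\}$ and $(\tfrac12,1)\times\{\tfrac12\}$ are identified with each other. Let $X_\infty$ be the quotient, by these identifications, of $P$ without the endpoints of the edges and the accumulation points of these endpoints, and let $\omega_\infty$ be the nowhere vanishing holomorphic $1$-form on the Riemann surface $X_\infty$ induced by $\mathrm dz$. A homeomorphism $\phi:X_\infty\to X_\infty$ is called affine if, in the canonical charts of $\omega_\infty$ (the local coordinates $z$ with $\mathrm dz=\omega_\infty$), it is given near every point by an invertible real affine map; orientation-reversing maps are allowed. A direction is a line through $0$ in $\mathbb R^2$, and $\phi$ sends the direction $\theta$ to the direction $\theta'$ if the derivative of $\phi$ maps the line $\theta$ to the line $\theta'$. **Lemma.** The vertical direction of $(X_\infty,\omega_\infty)$ is not affinely equivalent to any other direction: if $\phi$ is an affine homeomorphism of $(X_\infty,\omega_\infty)$ and $\theta$ is a direction other than the vertical one, then $\phi$ does not send $\theta$ to the vertical direction.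 -/

import Mathlib

open scoped Topology Manifold ContDiff LinearAlgebra.Projectivization

noncomputable section

namespace ArnouxYoccoz

/-! ### The polygon and its gluings

The plane is `ℂ`, so that the form `dz` on it is the standard one. The closed polygon is the union of
the upper rectangle `[0, 1] × [1/2, 1]` and the lower rectangle `[-1/2, 1/2] × [0, 1/2]`; the two
meet along the segment `[0, 1/2] × {1/2}`, which is inside the polygon. -/

/-- The interior of the polygon: the open upper rectangle, the open lower rectangle and the open
central rectangle `(0, 1/2) × (0, 1)`. -/
def polygonInterior : Set ℂ :=
  {z | (0 < z.re ∧ z.re < 1 ∧ 1 / 2 < z.im ∧ z.im < 1) ∨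
    (-1 / 2 < z.re ∧ z.re < 1 / 2 ∧ 0 < z.im ∧ z.im < 1 / 2) ∨
    (0 < z.re ∧ z.re < 1 / 2 ∧ 0 < z.im ∧ z.im < 1)}

/-- The size of the vertical displacement in the gluing of the edges `A n` and `B n`:
`2⁻ⁿ + 2⁻⁽ⁿ⁻²⁾ + 2⁻⁽ⁿ⁻⁴⁾ + ⋯`, the exponents going down to `2` or `1`. -/
def shift (n : ℕ) : ℝ :=
  if Even n then (1 - (1 / 2) ^ n) / 3 else (2 - (1 / 2) ^ n) / 3

/-- The gluing of the boundary of the polygon. `Glue z w` says that `z` and `w` lie on paired open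
edges and correspond to each other under the translation that identifies these edges. The edges
`A n`, `B n`, `C' n`, `C'' n` have length `1 / 2 ^ (n + 1)`, for `n ≥ 1`.
* `A n`: the right side `{1} × [1/2, 1]` of the upper rectangle is cut, from the bottom up, into
  `A 1, A 2, …`. The other copies of `A 2, A 4, …` lie, from the bottom up, on `{0} × [1/2, 2/3]`, and
  those of `A 1, A 3, …` on `{-1/2} × [0, 1/3]`.
* `B n`: the right side `{1/2} × [0, 1/2]` of the lower rectangle is cut, from the top down, into
  `B 1, B 2, …`. The other copies of `B 1, B 3, …` lie, from the top down, on `{0} × [2/3, 1]`, and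
  those of `B 2, B 4, …` on `{-1/2} × [1/3, 1/2]`.
* `C' n` and `C'' n`: the top side `[0, 1] × {1}` is cut, from left to right, into
  `C' 1, C'' 1, C' 2, C'' 2, …`, and the bottom side `[-1/2, 1/2] × {0}` into
  `C'' 1, C' 1, C'' 2, C' 2, …`.
* `D`: the remaining pair of edges, `[-1/2, 0] × {1/2}` and `[1/2, 1] × {1/2}`. -/
inductive Glue : ℂ → ℂ → Prop
  | A (n : ℕ) (y : ℝ) (hn : 1 ≤ n)
      (h₁ : 1 - (1 / 2) ^ n < y) (h₂ : y < 1 - (1 / 2) ^ (n + 1)) :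
      Glue ⟨1, y⟩ ⟨if Even n then 0 else -1 / 2, y - shift n⟩
  | B (n : ℕ) (y : ℝ) (hn : 1 ≤ n)
      (h₁ : (1 / 2) ^ (n + 1) < y) (h₂ : y < (1 / 2) ^ n) :
      Glue ⟨1 / 2, y⟩ ⟨if Even n then -1 / 2 else 0, y + shift n⟩
  | C' (n : ℕ) (x : ℝ) (hn : 1 ≤ n)
      (h₁ : 1 - 2 * (1 / 2) ^ n < x) (h₂ : x < 1 - 3 * (1 / 2) ^ (n + 1)) :
      Glue ⟨x, 1⟩ ⟨x + (1 / 2) ^ (n + 1) - 1 / 2, 0⟩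
  | C'' (n : ℕ) (x : ℝ) (hn : 1 ≤ n)
      (h₁ : 1 - 3 * (1 / 2) ^ (n + 1) < x) (h₂ : x < 1 - (1 / 2) ^ n) :
      Glue ⟨x, 1⟩ ⟨x - (1 / 2) ^ (n + 1) - 1 / 2, 0⟩
  | D (x : ℝ) (h₁ : -1 / 2 < x) (h₂ : x < 0) :
      Glue ⟨x, 1 / 2⟩ ⟨x + 1, 1 / 2⟩

/-- The closed polygon without the endpoints of the edges and their accumulation points: its
interior together with all the open edges. -/
def polygon : Set ℂ :=
  polygonInterior ∪ {z | ∃ w, Glue z w ∨ Glue w z}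

/-- The surface `X_∞`: the quotient of the polygon by the gluings, with the quotient topology. -/
def Surface : Type :=
  Quot fun p q : polygon => Glue p q

instance : TopologicalSpace Surface :=
  inferInstanceAs (TopologicalSpace (Quot fun p q : polygon => Glue p q))

/-- The projection of the polygon onto the surface. -/
def proj (p : polygon) : Surface := Quot.mk _ p

/-- The canonical charts of the form `ω_∞` that `dz` induces on the quotient: the local
homeomorphisms `e` from `X_∞` to `ℂ` with `de = ω_∞`, that is, which are translations, locally, when
they are read in the polygon. -/
def IsCanonicalChart (e : OpenPartialHomeomorph Surface ℂ) : Prop :=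
  ∀ p : polygon, proj p ∈ e.source →
    ∀ᶠ q in 𝓝 p, e (proj q) = e (proj p) + ((q : ℂ) - (p : ℂ))

/-! ### The canonical charts cover the surface -/

lemma half_pow_pos (n : ℕ) : (0 : ℝ) < (1 / 2) ^ n := by positivity

lemma half_pow_le {n : ℕ} (hn : 1 ≤ n) : ((1 / 2) ^ n : ℝ) ≤ 1 / 2 := by
  simpa using pow_le_pow_of_le_one (by norm_num : (0 : ℝ) ≤ 1 / 2) (by norm_num) hn

lemma half_pow_le' {n : ℕ} (hn : 1 ≤ n) (he : Even n) : ((1 / 2) ^ n : ℝ) ≤ 1 / 4 := by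
  have h2 : 2 ≤ n := by obtain ⟨k, rfl⟩ := he; omega
  have := pow_le_pow_of_le_one (by norm_num : (0 : ℝ) ≤ 1 / 2) (by norm_num) h2
  norm_num at this ⊢
  linarith

lemma half_pow_cases (n m : ℕ) :
    n = m ∨ ((1 / 2) ^ n : ℝ) ≤ (1 / 2) ^ m / 2 ∨ ((1 / 2) ^ m : ℝ) ≤ (1 / 2) ^ n / 2 := by
  have key : ∀ a b : ℕ, a < b → ((1 / 2) ^ b : ℝ) ≤ (1 / 2) ^ a / 2 := by
    intro a b h
    have := pow_le_pow_of_le_one (by norm_num : (0 : ℝ) ≤ 1 / 2) (by norm_num)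
      (Nat.succ_le_of_lt h)
    rw [pow_succ] at this
    linarith
  rcases lt_trichotomy n m with h | h | h
  · exact Or.inr (Or.inr (key _ _ h))
  · exact Or.inl h
  · exact Or.inr (Or.inl (key _ _ h))

lemma half_pow_cases' (n m : ℕ) (h : Even n ↔ Even m) :
    n = m ∨ ((1 / 2) ^ n : ℝ) ≤ (1 / 2) ^ m / 4 ∨ ((1 / 2) ^ m : ℝ) ≤ (1 / 2) ^ n / 4 := by
  have key : ∀ a b : ℕ, a + 2 ≤ b → ((1 / 2) ^ b : ℝ) ≤ (1 / 2) ^ a / 4 := by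
    intro a b h
    have := pow_le_pow_of_le_one (by norm_num : (0 : ℝ) ≤ 1 / 2) (by norm_num) h
    rw [pow_add] at this
    norm_num at this ⊢
    linarith
  have : n = m ∨ m + 2 ≤ n ∨ n + 2 ≤ m := by
    rw [Nat.even_iff, Nat.even_iff] at h
    omega
  rcases this with h | h | h
  · exact Or.inl h
  · exact Or.inr (Or.inl (key _ _ h))
  · exact Or.inr (Or.inr (key _ _ h))

/-- Rough position of the first of two glued points. -/
lemma Glue.left {z w : ℂ} (h : Glue z w) :
    (z.re = 1 ∧ 1 / 2 < z.im ∧ z.im < 1) ∨ (z.re = 1 / 2 ∧ 0 < z.im ∧ z.im < 1 / 2) ∨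
    (0 < z.re ∧ z.re < 1 ∧ z.im = 1) ∨ (-1 / 2 < z.re ∧ z.re < 0 ∧ z.im = 1 / 2) := by
  cases h with
  | A n y hn h₁ h₂ =>
    have := half_pow_le hn; have := half_pow_pos (n + 1)
    left; exact ⟨rfl, by simp only; linarith, by simp only; linarith⟩
  | B n y hn h₁ h₂ =>
    have := half_pow_le hn; have := half_pow_pos (n + 1)
    right; left; exact ⟨rfl, by simp only; linarith, by simp only; linarith⟩
  | C' n x hn h₁ h₂ =>
    have := half_pow_le hn; have := half_pow_pos (n + 1)
    right; right; left; exact ⟨by simp only; linarith, by simp only; linarith, rfl⟩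
  | C'' n x hn h₁ h₂ =>
    have := half_pow_le hn; have := half_pow_pos n
    rw [pow_succ] at h₁
    right; right; left; exact ⟨by simp only; linarith, by simp only; linarith, rfl⟩
  | D x h₁ h₂ => right; right; right; exact ⟨h₁, h₂, rfl⟩

/-- Rough position of the second of two glued points. -/
lemma Glue.right {z w : ℂ} (h : Glue z w) :
    (w.re = 0 ∧ 1 / 2 < w.im ∧ w.im < 1) ∨ (w.re = -1 / 2 ∧ 0 < w.im ∧ w.im < 1 / 2) ∨
    (-1 / 2 < w.re ∧ w.re < 1 / 2 ∧ w.im = 0) ∨ (1 / 2 < w.re ∧ w.re < 1 ∧ w.im = 1 / 2) := by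
  cases h with
  | A n y hn h₁ h₂ =>
    have := half_pow_le hn; have := half_pow_pos n
    rw [pow_succ] at h₂
    by_cases he : Even n
    · have := half_pow_le' hn he
      left
      simp only [shift, he, if_true]
      exact ⟨trivial, by linarith, by linarith⟩
    · right; left
      simp only [shift, he, if_false]
      exact ⟨trivial, by linarith, by linarith⟩
  | B n y hn h₁ h₂ =>
    have := half_pow_le hn; have := half_pow_pos n
    rw [pow_succ] at h₁
    by_cases he : Even n
    · have := half_pow_le' hn he
      right; left
      simp only [shift, he, if_true]
      exact ⟨trivial, by linarith, by linarith⟩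
    · left
      simp only [shift, he, if_false]
      exact ⟨trivial, by linarith, by linarith⟩
  | C' n x hn h₁ h₂ =>
    have := half_pow_le hn; have := half_pow_pos n
    rw [pow_succ] at h₂
    right; right; left
    simp only [pow_succ]
    exact ⟨by linarith, by linarith, trivial⟩
  | C'' n x hn h₁ h₂ =>
    have := half_pow_le hn; have := half_pow_pos n
    rw [pow_succ] at h₁
    right; right; left
    simp only [pow_succ]
    exact ⟨by linarith, by linarith, trivial⟩
  | D x h₁ h₂ =>
    right; right; right
    exact ⟨by simp only; linarith, by simp only; linarith, rfl⟩

lemma Glue.left_notMem {z w : ℂ} (h : Glue z w) : z ∉ polygonInterior := by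
  simp only [polygonInterior, Set.mem_ofPred_eq]
  rcases h.left with h | h | h | h <;> rintro (h' | h' | h') <;> linarith [h.1, h.2.1, h.2.2]

lemma Glue.right_notMem {z w : ℂ} (h : Glue z w) : w ∉ polygonInterior := by
  simp only [polygonInterior, Set.mem_ofPred_eq]
  rcases h.right with h | h | h | h <;> rintro (h' | h' | h') <;> linarith [h.1, h.2.1, h.2.2]

lemma Glue.not_chain {z w v : ℂ} (h : Glue z w) : ¬ Glue w v := by
  intro h'
  rcases h.right with h | h | h | h <;> rcases h'.left with h' | h' | h' | h' <;>
    linarith [h.1, h.2.1, h.2.2]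

lemma Glue.of_re_one {z w : ℂ} (h : Glue z w) (hz : z.re = 1) :
    ∃ n : ℕ, 1 - (1 / 2) ^ n < z.im ∧ z.im < 1 - (1 / 2) ^ n / 2 ∧
      w = ⟨if Even n then 0 else -1 / 2, z.im - shift n⟩ := by
  have hl := h.left
  cases h with
  | A n y hn h₁ h₂ => rw [pow_succ] at h₂; exact ⟨n, h₁, by simp only; linarith, rfl⟩
  | _ => exfalso; simp only at hl hz; rcases hl with h | h | h | h <;> linarith [h.1, h.2.1, h.2.2]

lemma Glue.of_re_half {z w : ℂ} (h : Glue z w) (hz : z.re = 1 / 2) (hz' : z.im < 1 / 2) :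
    ∃ n : ℕ, (1 / 2) ^ n / 2 < z.im ∧ z.im < (1 / 2) ^ n ∧
      w = ⟨if Even n then -1 / 2 else 0, z.im + shift n⟩ := by
  have hl := h.left
  cases h with
  | B n y hn h₁ h₂ => rw [pow_succ] at h₁; exact ⟨n, by simp only; linarith, h₂, rfl⟩
  | _ =>
    exfalso; simp only at hl hz hz'
    rcases hl with h | h | h | h <;> linarith [h.1, h.2.1, h.2.2]

lemma Glue.of_im_one {z w : ℂ} (h : Glue z w) (hz : z.im = 1) :
    ∃ n : ℕ, (1 - 2 * (1 / 2) ^ n < z.re ∧ z.re < 1 - 3 / 2 * (1 / 2) ^ n ∧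
        w = ⟨z.re + (1 / 2) ^ n / 2 - 1 / 2, 0⟩) ∨
      (1 - 3 / 2 * (1 / 2) ^ n < z.re ∧ z.re < 1 - (1 / 2) ^ n ∧
        w = ⟨z.re - (1 / 2) ^ n / 2 - 1 / 2, 0⟩) := by
  have hl := h.left
  cases h with
  | C' n x hn h₁ h₂ =>
    refine ⟨n, Or.inl ⟨h₁, ?_, ?_⟩⟩
    · rw [pow_succ] at h₂; simp only; linarith
    · rw [pow_succ]; congr 1; ring
  | C'' n x hn h₁ h₂ =>
    refine ⟨n, Or.inr ⟨?_, h₂, ?_⟩⟩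
    · rw [pow_succ] at h₁; simp only; linarith
    · rw [pow_succ]; congr 1; ring
  | B n y hn h₁ h₂ =>
    exfalso; simp only at hz
    linarith [half_pow_le hn]
  | _ =>
    exfalso; simp only at hl hz
    rcases hl with h | h | h | h <;> linarith [h.1, h.2.1, h.2.2]

lemma Glue.of_re_neg {z w : ℂ} (h : Glue z w) (hz : z.re < 0) : w = ⟨z.re + 1, 1 / 2⟩ := by
  have hl := h.left
  cases h with
  | D x h₁ h₂ => rfl
  | _ =>
    exfalso; simp only at hl hz
    rcases hl with h | h | h | h <;> linarith [h.1, h.2.1, h.2.2]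

lemma Glue.functional {z w w' : ℂ} (h : Glue z w) (h' : Glue z w') : w = w' := by
  rcases h.left with hz | hz | hz | hz
  · obtain ⟨n, h₁, h₂, rfl⟩ := h.of_re_one hz.1
    obtain ⟨m, h₁', h₂', rfl⟩ := h'.of_re_one hz.1
    rcases half_pow_cases n m with rfl | h | h
    · rfl
    all_goals linarith
  · obtain ⟨n, h₁, h₂, rfl⟩ := h.of_re_half hz.1 hz.2.2
    obtain ⟨m, h₁', h₂', rfl⟩ := h'.of_re_half hz.1 hz.2.2
    rcases half_pow_cases n m with rfl | h | h
    · rfl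
    all_goals linarith
  · obtain ⟨n, ⟨h₁, h₂, rfl⟩ | ⟨h₁, h₂, rfl⟩⟩ := h.of_im_one hz.2.2 <;>
    obtain ⟨m, ⟨h₁', h₂', rfl⟩ | ⟨h₁', h₂', rfl⟩⟩ := h'.of_im_one hz.2.2 <;>
    have := half_pow_pos n <;> have := half_pow_pos m <;>
    rcases half_pow_cases n m with rfl | h | h <;>
    first | rfl | (exfalso; linarith)
  · rw [h.of_re_neg hz.2.1, h'.of_re_neg hz.2.1]

lemma Glue.of_right_zero {z w : ℂ} (h : Glue z w) (hw : w.re = 0) (hw' : 1 / 2 < w.im) :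
    ∃ n : ℕ, (Even n ∧ 2 / 3 - 2 / 3 * (1 / 2) ^ n < w.im ∧ w.im < 2 / 3 - (1 / 2) ^ n / 6 ∧
        z = ⟨1, w.im + (1 - (1 / 2) ^ n) / 3⟩) ∨
      (¬ Even n ∧ 2 / 3 + (1 / 2) ^ n / 6 < w.im ∧ w.im < 2 / 3 + 2 / 3 * (1 / 2) ^ n ∧
        z = ⟨1 / 2, w.im - (2 - (1 / 2) ^ n) / 3⟩) := by
  have hr := h.right
  cases h with
  | A n y hn h₁ h₂ =>
    rw [pow_succ] at h₂
    by_cases he : Even n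
    · refine ⟨n, Or.inl ?_⟩
      simp only [shift, he, if_true]
      refine ⟨trivial, by linarith, by linarith, ?_⟩
      congr 1; ring
    · exfalso
      simp only [he, if_false] at hw
      norm_num at hw
  | B n y hn h₁ h₂ =>
    rw [pow_succ] at h₁
    by_cases he : Even n
    · exfalso
      simp only [he, if_true] at hw
      norm_num at hw
    · refine ⟨n, Or.inr ?_⟩
      simp only [shift, he, if_false]
      refine ⟨not_false, by linarith, by linarith, ?_⟩
      congr 1; ring
  | _ =>
    exfalso; simp only at hr hw hw'
    rcases hr with h | h | h | h <;> linarith [h.1, h.2.1, h.2.2]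

lemma Glue.of_right_half {z w : ℂ} (h : Glue z w) (hw : w.re = -1 / 2) (hw' : 0 < w.im) :
    ∃ n : ℕ, (¬ Even n ∧ 1 / 3 - 2 / 3 * (1 / 2) ^ n < w.im ∧ w.im < 1 / 3 - (1 / 2) ^ n / 6 ∧
        z = ⟨1, w.im + (2 - (1 / 2) ^ n) / 3⟩) ∨
      (Even n ∧ 1 / 3 + (1 / 2) ^ n / 6 < w.im ∧ w.im < 1 / 3 + 2 / 3 * (1 / 2) ^ n ∧
        z = ⟨1 / 2, w.im - (1 - (1 / 2) ^ n) / 3⟩) := by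
  have hr := h.right
  cases h with
  | A n y hn h₁ h₂ =>
    rw [pow_succ] at h₂
    by_cases he : Even n
    · exfalso
      simp only [he, if_true] at hw
      norm_num at hw
    · refine ⟨n, Or.inl ?_⟩
      simp only [shift, he, if_false]
      refine ⟨not_false, by linarith, by linarith, ?_⟩
      congr 1; ring
  | B n y hn h₁ h₂ =>
    rw [pow_succ] at h₁
    by_cases he : Even n
    · refine ⟨n, Or.inr ?_⟩
      simp only [shift, he, if_true]
      refine ⟨trivial, by linarith, by linarith, ?_⟩
      congr 1; ring
    · exfalso
      simp only [he, if_false] at hw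
      norm_num at hw
  | _ =>
    exfalso; simp only at hr hw hw'
    rcases hr with h | h | h | h <;> linarith [h.1, h.2.1, h.2.2]

lemma Glue.of_right_im_zero {z w : ℂ} (h : Glue z w) (hw : w.im = 0) :
    ∃ n : ℕ, (1 / 2 - 3 / 2 * (1 / 2) ^ n < w.re ∧ w.re < 1 / 2 - (1 / 2) ^ n ∧
        z = ⟨w.re - (1 / 2) ^ n / 2 + 1 / 2, 1⟩) ∨
      (1 / 2 - 2 * (1 / 2) ^ n < w.re ∧ w.re < 1 / 2 - 3 / 2 * (1 / 2) ^ n ∧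
        z = ⟨w.re + (1 / 2) ^ n / 2 + 1 / 2, 1⟩) := by
  have hr := h.right
  cases h with
  | C' n x hn h₁ h₂ =>
    refine ⟨n, Or.inl ⟨?_, ?_, ?_⟩⟩
    · simp only [pow_succ]; linarith
    · simp only [pow_succ] at h₂ ⊢; linarith
    · simp only [pow_succ]; congr 1; ring
  | C'' n x hn h₁ h₂ =>
    refine ⟨n, Or.inr ⟨?_, ?_, ?_⟩⟩
    · simp only [pow_succ] at h₁ ⊢; linarith
    · simp only [pow_succ]; linarith
    · simp only [pow_succ]; congr 1; ring
  | A n y hn h₁ h₂ =>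
    exfalso; simp only at hw
    rw [shift] at hw
    have h₃ := half_pow_pos n
    rw [pow_succ] at h₂
    split_ifs at hw with he
    · linarith [half_pow_le' hn he]
    · linarith [half_pow_le hn]
  | B n y hn h₁ h₂ =>
    exfalso; simp only at hw
    rw [shift] at hw
    have h₃ := half_pow_pos (n + 1)
    split_ifs at hw with he <;> linarith [half_pow_le hn]
  | _ =>
    exfalso; simp only at hr hw
    rcases hr with h | h | h | h <;> linarith [h.1, h.2.1, h.2.2]

lemma Glue.of_right_re {z w : ℂ} (h : Glue z w) (hw : 1 / 2 < w.re) : z = ⟨w.re - 1, 1 / 2⟩ := by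
  have hr := h.right
  cases h with
  | D x h₁ h₂ => congr 1; simp
  | A n y hn h₁ h₂ => exfalso; simp only at hw; split_ifs at hw <;> linarith
  | B n y hn h₁ h₂ => exfalso; simp only at hw; split_ifs at hw <;> linarith
  | _ =>
    exfalso; simp only at hr hw
    rcases hr with h | h | h | h <;> linarith [h.1, h.2.1, h.2.2]

lemma Glue.injective {z z' w : ℂ} (h : Glue z w) (h' : Glue z' w) : z = z' := by
  rcases h.right with hw | hw | hw | hw
  · obtain ⟨n, ⟨he, h₁, h₂, rfl⟩ | ⟨he, h₁, h₂, rfl⟩⟩ := h.of_right_zero hw.1 hw.2.1 <;>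
    obtain ⟨m, ⟨he', h₁', h₂', rfl⟩ | ⟨he', h₁', h₂', rfl⟩⟩ := h'.of_right_zero hw.1 hw.2.1 <;>
    have := half_pow_pos n <;> have := half_pow_pos m <;>
    first
    | (exfalso; linarith)
    | (rcases half_pow_cases' n m (by tauto) with rfl | h | h <;>
        first | rfl | (exfalso; linarith))
  · obtain ⟨n, ⟨he, h₁, h₂, rfl⟩ | ⟨he, h₁, h₂, rfl⟩⟩ := h.of_right_half hw.1 hw.2.1 <;>
    obtain ⟨m, ⟨he', h₁', h₂', rfl⟩ | ⟨he', h₁', h₂', rfl⟩⟩ := h'.of_right_half hw.1 hw.2.1 <;>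
    have := half_pow_pos n <;> have := half_pow_pos m <;>
    first
    | (exfalso; linarith)
    | (rcases half_pow_cases' n m (by tauto) with rfl | h | h <;>
        first | rfl | (exfalso; linarith))
  · obtain ⟨n, ⟨h₁, h₂, rfl⟩ | ⟨h₁, h₂, rfl⟩⟩ := h.of_right_im_zero hw.2.2 <;>
    obtain ⟨m, ⟨h₁', h₂', rfl⟩ | ⟨h₁', h₂', rfl⟩⟩ := h'.of_right_im_zero hw.2.2 <;>
    have := half_pow_pos n <;> have := half_pow_pos m <;>
    rcases half_pow_cases n m with rfl | h | h <;>
    first | rfl | (exfalso; linarith)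
  · rw [h.of_right_re hw.1, h'.of_right_re hw.1]

/-- Two points of the polygon give the same point of the surface exactly if they are equal or
glued. -/
lemma proj_eq_iff {p q : polygon} :
    proj p = proj q ↔ p = q ∨ Glue p q ∨ Glue q p := by
  have key : ∀ p q : polygon, Relation.EqvGen (fun p q : polygon => Glue p q) p q →
      p = q ∨ Glue p q ∨ Glue q p := by
    intro p q h
    induction h with
    | rel a b h => exact Or.inr (Or.inl h)
    | refl a => exact Or.inl rfl
    | symm a b _ ih =>
      rcases ih with h | h | h
      · exact Or.inl h.symm
      · exact Or.inr (Or.inr h)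
      · exact Or.inr (Or.inl h)
    | trans a b c h₁ h₂ ih₁ ih₂ =>
      rcases ih₁ with rfl | h | h
      · exact ih₂
      · rcases ih₂ with rfl | h' | h'
        · exact Or.inr (Or.inl h)
        · exact absurd h' h.not_chain
        · exact Or.inl (Subtype.ext (h.injective h'))
      · rcases ih₂ with rfl | h' | h'
        · exact Or.inr (Or.inr h)
        · exact Or.inl (Subtype.ext (h.functional h'))
        · exact absurd h h'.not_chain
  constructor
  · intro h
    exact key p q (Quot.eqvGen_exact h)
  · rintro (rfl | h | h)
    · rfl
    · exact Quot.sound (r := fun p q : polygon => Glue p q) h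
    · exact (Quot.sound (r := fun p q : polygon => Glue p q) h).symm

lemma continuous_proj : Continuous proj := continuous_quot_mk

lemma surjective_proj : Function.Surjective proj := Quot.exists_rep

lemma isOpen_surface_iff {s : Set Surface} : IsOpen s ↔ IsOpen (proj ⁻¹' s) := Iff.rfl

lemma isOpen_polygonInterior : IsOpen polygonInterior := by
  have h : ∀ a b c d : ℝ, IsOpen {z : ℂ | a < z.re ∧ z.re < b ∧ c < z.im ∧ z.im < d} := by
    intro a b c d
    have hre := Complex.continuous_re
    have him := Complex.continuous_im
    exact (isOpen_lt continuous_const hre).inter ((isOpen_lt hre continuous_const).inter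
      ((isOpen_lt continuous_const him).inter (isOpen_lt him continuous_const)))
  exact (h _ _ _ _).union ((h _ _ _ _).union (h _ _ _ _))

lemma polygonInterior_subset : polygonInterior ⊆ polygon := Set.subset_union_left

lemma Glue.left_mem {z w : ℂ} (h : Glue z w) : z ∈ polygon := Or.inr ⟨w, Or.inl h⟩

lemma Glue.right_mem {z w : ℂ} (h : Glue z w) : w ∈ polygon := Or.inr ⟨z, Or.inr h⟩

/-- The polygon is contained in the union of the two closed rectangles. -/
lemma mem_closed_of_mem {z : ℂ} (h : z ∈ polygon) :
    (0 ≤ z.re ∧ z.re ≤ 1 ∧ 1 / 2 ≤ z.im ∧ z.im ≤ 1) ∨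
    (-1 / 2 ≤ z.re ∧ z.re ≤ 1 / 2 ∧ 0 ≤ z.im ∧ z.im ≤ 1 / 2) := by
  rcases h with h | ⟨w, h | h⟩
  · rcases h with h | h | h
    · exact Or.inl ⟨by linarith [h.1], by linarith [h.2.1], by linarith [h.2.2.1], by linarith [h.2.2.2]⟩
    · exact Or.inr ⟨by linarith [h.1], by linarith [h.2.1], by linarith [h.2.2.1], by linarith [h.2.2.2]⟩
    · rcases le_total (1 / 2) z.im with h' | h'
      · exact Or.inl ⟨by linarith [h.1], by linarith [h.2.1], h', by linarith [h.2.2.2]⟩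
      · exact Or.inr ⟨by linarith [h.1], by linarith [h.2.1], by linarith [h.2.2.1], h'⟩
  · rcases h.left with ⟨h₁, h₂, h₃⟩ | ⟨h₁, h₂, h₃⟩ | ⟨h₁, h₂, h₃⟩ | ⟨h₁, h₂, h₃⟩
    · left; refine ⟨?_, ?_, ?_, ?_⟩ <;> linarith
    · right; refine ⟨?_, ?_, ?_, ?_⟩ <;> linarith
    · left; refine ⟨?_, ?_, ?_, ?_⟩ <;> linarith
    · right; refine ⟨?_, ?_, ?_, ?_⟩ <;> linarith
  · rcases h.right with ⟨h₁, h₂, h₃⟩ | ⟨h₁, h₂, h₃⟩ | ⟨h₁, h₂, h₃⟩ | ⟨h₁, h₂, h₃⟩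
    · left; refine ⟨?_, ?_, ?_, ?_⟩ <;> linarith
    · right; refine ⟨?_, ?_, ?_, ?_⟩ <;> linarith
    · right; refine ⟨?_, ?_, ?_, ?_⟩ <;> linarith
    · left; refine ⟨?_, ?_, ?_, ?_⟩ <;> linarith

lemma mem_upper {z : ℂ} (h₁ : 0 < z.re) (h₂ : z.re < 1) (h₃ : 1 / 2 < z.im) (h₄ : z.im < 1) :
    z ∈ polygonInterior := Or.inl ⟨h₁, h₂, h₃, h₄⟩

lemma mem_lower {z : ℂ} (h₁ : -1 / 2 < z.re) (h₂ : z.re < 1 / 2) (h₃ : 0 < z.im)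
    (h₄ : z.im < 1 / 2) : z ∈ polygonInterior := Or.inr (Or.inl ⟨h₁, h₂, h₃, h₄⟩)

lemma Glue.halfDiscs_vertical {z w ζ : ℂ} (h : Glue ⟨z.re, z.im + ζ.im⟩ ⟨w.re, w.im + ζ.im⟩)
    (hz : z.re = 1 ∨ z.re = 1 / 2 ∧ z.im + ζ.im < 1 / 2) (hw : w.re = 0 ∨ w.re = -1 / 2)
    (hζ : |ζ.re| < 1 / 4) :
    (ζ.re < 0 → z + ζ ∈ polygonInterior ∧ w + ζ ∉ polygon) ∧
      (ζ.re = 0 → Glue (z + ζ) (w + ζ)) ∧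
      (0 < ζ.re → w + ζ ∈ polygonInterior ∧ z + ζ ∉ polygon) := by
  obtain ⟨b₁, b₂⟩ := abs_lt.1 hζ
  have hl : (z.re = 1 ∧ 1 / 2 < z.im + ζ.im ∧ z.im + ζ.im < 1) ∨
      (z.re = 1 / 2 ∧ 0 < z.im + ζ.im ∧ z.im + ζ.im < 1 / 2) := by
    rcases h.left with h' | h' | h' | h' <;> simp only at h'
    · exact Or.inl h'
    · exact Or.inr h'
    · exfalso; rcases hz with hz | hz <;> linarith [h'.1, h'.2.1, h'.2.2]
    · exfalso; rcases hz with hz | hz <;> linarith [h'.1, h'.2.1, h'.2.2]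
  have hr : (w.re = 0 ∧ 1 / 2 < w.im + ζ.im ∧ w.im + ζ.im < 1) ∨
      (w.re = -1 / 2 ∧ 0 < w.im + ζ.im ∧ w.im + ζ.im < 1 / 2) := by
    rcases h.right with h' | h' | h' | h'
    · exact Or.inl h'
    · exact Or.inr h'
    · exfalso
      obtain ⟨n, ⟨-, -, e⟩ | ⟨-, -, e⟩⟩ := h.of_right_im_zero h'.2.2 <;>
      · have := congrArg Complex.im e
        simp only at this
        rcases hl with hl | hl <;> linarith [hl.2.2]
    · exfalso; simp only at h'; rcases hw with hw | hw <;> linarith [h'.1]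
  refine ⟨fun hn => ⟨?_, fun hm => ?_⟩, fun h₀ => ?_, fun hp => ⟨?_, fun hm => ?_⟩⟩
  · rcases hl with hl | hl
    · apply mem_upper <;> simp only [Complex.add_re, Complex.add_im] <;>
        linarith [hl.1, hl.2.1, hl.2.2]
    · apply mem_lower <;> simp only [Complex.add_re, Complex.add_im] <;>
        linarith [hl.1, hl.2.1, hl.2.2]
  · have := mem_closed_of_mem hm
    simp only [Complex.add_re, Complex.add_im] at this
    rcases hr with hr | hr <;> rcases this with h' | h' <;>
      linarith [hr.1, hr.2.1, hr.2.2, h'.1, h'.2.1, h'.2.2.1, h'.2.2.2]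
  · convert h using 1 <;> apply Complex.ext <;> simp [h₀]
  · rcases hr with hr | hr
    · apply mem_upper <;> simp only [Complex.add_re, Complex.add_im] <;>
        linarith [hr.1, hr.2.1, hr.2.2]
    · apply mem_lower <;> simp only [Complex.add_re, Complex.add_im] <;>
        linarith [hr.1, hr.2.1, hr.2.2]
  · have := mem_closed_of_mem hm
    simp only [Complex.add_re, Complex.add_im] at this
    rcases hl with hl | hl <;> rcases this with h' | h' <;>
      linarith [hl.1, hl.2.1, hl.2.2, h'.1, h'.2.1, h'.2.2.1, h'.2.2.2]

lemma Glue.halfDiscs_horizontal {z w ζ : ℂ} (h : Glue ⟨z.re + ζ.re, z.im⟩ ⟨w.re + ζ.re, w.im⟩)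
    (hzw : z.im = 1 ∧ w.im = 0 ∨ z.im = 1 / 2 ∧ w.im = 1 / 2 ∧ z.re + ζ.re < 0 ∧ 1 / 2 < w.re + ζ.re)
    (hζ : |ζ.im| < 1 / 4) :
    (ζ.im < 0 → z + ζ ∈ polygonInterior ∧ w + ζ ∉ polygon) ∧
      (ζ.im = 0 → Glue (z + ζ) (w + ζ)) ∧
      (0 < ζ.im → w + ζ ∈ polygonInterior ∧ z + ζ ∉ polygon) := by
  obtain ⟨b₁, b₂⟩ := abs_lt.1 hζ
  have hl : (0 < z.re + ζ.re ∧ z.re + ζ.re < 1 ∧ z.im = 1) ∨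
      (-1 / 2 < z.re + ζ.re ∧ z.re + ζ.re < 0 ∧ z.im = 1 / 2) := by
    rcases h.left with h' | h' | h' | h' <;> simp only at h'
    · exfalso; rcases hzw with hz | hz <;> linarith [h'.1, h'.2.1, h'.2.2, hz.1]
    · exfalso; rcases hzw with hz | hz
      · linarith [h'.1, h'.2.1, h'.2.2, hz.1]
      · linarith [h'.1, h'.2.1, h'.2.2, hz.1]
    · exact Or.inl h'
    · exact Or.inr h'
  have hr : (-1 / 2 < w.re + ζ.re ∧ w.re + ζ.re < 1 / 2 ∧ w.im = 0) ∨
      (1 / 2 < w.re + ζ.re ∧ w.re + ζ.re < 1 ∧ w.im = 1 / 2) := by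
    rcases h.right with h' | h' | h' | h' <;> simp only at h'
    · exfalso; rcases hzw with hz | hz
      · linarith [h'.2.1, hz.2]
      · linarith [h'.1, h'.2.1, h'.2.2, hz.2.1]
    · exfalso; rcases hzw with hz | hz
      · linarith [h'.2.1, hz.2]
      · linarith [h'.1, h'.2.1, h'.2.2, hz.2.1]
    · exact Or.inl h'
    · exact Or.inr h'
  refine ⟨fun hn => ⟨?_, fun hm => ?_⟩, fun h₀ => ?_, fun hp => ⟨?_, fun hm => ?_⟩⟩
  · rcases hl with hl | hl
    · apply mem_upper <;> simp only [Complex.add_re, Complex.add_im] <;>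
        linarith [hl.1, hl.2.1, hl.2.2]
    · apply mem_lower <;> simp only [Complex.add_re, Complex.add_im] <;>
        linarith [hl.1, hl.2.1, hl.2.2]
  · have := mem_closed_of_mem hm
    simp only [Complex.add_re, Complex.add_im] at this
    rcases hr with hr | hr <;> rcases this with h' | h' <;>
      linarith [hr.1, hr.2.1, hr.2.2, h'.1, h'.2.1, h'.2.2.1, h'.2.2.2]
  · convert h using 1 <;> apply Complex.ext <;> simp [h₀]
  · rcases hr with hr | hr
    · apply mem_lower <;> simp only [Complex.add_re, Complex.add_im] <;>
        linarith [hr.1, hr.2.1, hr.2.2]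
    · apply mem_upper <;> simp only [Complex.add_re, Complex.add_im] <;>
        linarith [hr.1, hr.2.1, hr.2.2]
  · have := mem_closed_of_mem hm
    simp only [Complex.add_re, Complex.add_im] at this
    rcases hl with hl | hl <;> rcases this with h' | h' <;>
      linarith [hl.1, hl.2.1, hl.2.2, h'.1, h'.2.1, h'.2.2.1, h'.2.2.2]

/-- Near a pair of glued points, the polygon consists of two opposite half discs, which are glued
along their diameters. -/
lemma Glue.exists_halfDiscs {z w : ℂ} (h : Glue z w) :
    ∃ (L : ℂ → ℝ) (r : ℝ), Continuous L ∧ L 0 = 0 ∧ 0 < r ∧ r ≤ 1 / 4 ∧ ∀ ζ : ℂ, ‖ζ‖ < r →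
      (L ζ < 0 → z + ζ ∈ polygonInterior ∧ w + ζ ∉ polygon) ∧
      (L ζ = 0 → Glue (z + ζ) (w + ζ)) ∧
      (0 < L ζ → w + ζ ∈ polygonInterior ∧ z + ζ ∉ polygon) := by
  have hd : ∀ a b x : ℝ, a < x → x < b → 0 < min (1 / 4) (min (x - a) (b - x)) := by
    intro a b x h₁ h₂
    have := sub_pos.2 h₁
    have := sub_pos.2 h₂
    positivity
  have hlt : ∀ {a b x : ℝ} {ζ : ℂ}, ‖ζ‖ < min (1 / 4) (min (x - a) (b - x)) →
      |ζ.re| < 1 / 4 ∧ |ζ.im| < 1 / 4 ∧ a < x + ζ.re ∧ x + ζ.re < b ∧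
      a < x + ζ.im ∧ x + ζ.im < b := by
    intro a b x ζ hζ
    simp only [lt_min_iff] at hζ
    have h₁ := Complex.abs_re_le_norm ζ
    have h₂ := Complex.abs_im_le_norm ζ
    have h₃ := abs_le.1 h₁
    have h₄ := abs_le.1 h₂
    refine ⟨by linarith, by linarith, ?_, ?_, ?_, ?_⟩ <;> linarith
  cases h with
  | A n y hn h₁ h₂ =>
    refine ⟨Complex.re, _, Complex.continuous_re, rfl, hd _ _ _ h₁ h₂, min_le_left _ _, ?_⟩
    intro ζ hζ
    obtain ⟨b₁, -, -, -, b₃, b₄⟩ := hlt hζ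
    have h := Glue.A n (y + ζ.im) hn b₃ b₄
    rw [add_sub_right_comm] at h
    refine Glue.halfDiscs_vertical h (Or.inl rfl) ?_ b₁
    by_cases he : Even n <;> simp [he]
  | B n y hn h₁ h₂ =>
    refine ⟨Complex.re, _, Complex.continuous_re, rfl, hd _ _ _ h₁ h₂, min_le_left _ _, ?_⟩
    intro ζ hζ
    obtain ⟨b₁, -, -, -, b₃, b₄⟩ := hlt hζ
    have h := Glue.B n (y + ζ.im) hn b₃ b₄
    rw [add_right_comm] at h
    refine Glue.halfDiscs_vertical h (Or.inr ⟨rfl, by linarith [half_pow_le hn]⟩) ?_ b₁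
    by_cases he : Even n <;> simp [he]
  | C' n x hn h₁ h₂ =>
    refine ⟨Complex.im, _, Complex.continuous_im, rfl, hd _ _ _ h₁ h₂, min_le_left _ _, ?_⟩
    intro ζ hζ
    obtain ⟨-, b₂, b₃, b₄, -, -⟩ := hlt hζ
    have h := Glue.C' n (x + ζ.re) hn b₃ b₄
    rw [add_right_comm, add_sub_right_comm] at h
    exact Glue.halfDiscs_horizontal h (Or.inl ⟨rfl, rfl⟩) b₂
  | C'' n x hn h₁ h₂ =>
    refine ⟨Complex.im, _, Complex.continuous_im, rfl, hd _ _ _ h₁ h₂, min_le_left _ _, ?_⟩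
    intro ζ hζ
    obtain ⟨-, b₂, b₃, b₄, -, -⟩ := hlt hζ
    have h := Glue.C'' n (x + ζ.re) hn b₃ b₄
    rw [add_sub_right_comm, add_sub_right_comm] at h
    exact Glue.halfDiscs_horizontal h (Or.inl ⟨rfl, rfl⟩) b₂
  | D x h₁ h₂ =>
    refine ⟨Complex.im, _, Complex.continuous_im, rfl, hd _ _ _ h₁ h₂, min_le_left _ _, ?_⟩
    intro ζ hζ
    obtain ⟨-, b₂, b₃, b₄, -, -⟩ := hlt hζ
    have h := Glue.D (x + ζ.re) b₃ b₄
    rw [add_right_comm] at h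
    refine Glue.halfDiscs_horizontal h (Or.inr ⟨rfl, rfl, b₄, ?_⟩) b₂
    simp only
    linarith

lemma Glue.half_le_norm_sub {z w : ℂ} (h : Glue z w) : 1 / 2 ≤ ‖z - w‖ := by
  have h₁ := Complex.abs_re_le_norm (z - w)
  have h₂ := Complex.abs_im_le_norm (z - w)
  have h₃ := abs_le.1 h₁
  have h₄ := abs_le.1 h₂
  cases h with
  | A n y hn => by_cases he : Even n <;> simp only [Complex.sub_re, he, if_true, if_false] at h₃ ⊢ <;> linarith
  | B n y hn => by_cases he : Even n <;> simp only [Complex.sub_re, he, if_true, if_false] at h₃ ⊢ <;> linarith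
  | C' n x hn => simp only [Complex.sub_im] at h₄; linarith
  | C'' n x hn => simp only [Complex.sub_im] at h₄; linarith
  | D x => simp only [Complex.sub_re] at h₃; linarith

/-- A local parametrization of the surface that is given by one or two pieces of the polygon is the
inverse of a canonical chart. -/
lemma exists_chart_of_param {z w : ℂ} {r : ℝ} (hr : 0 < r) (c : Metric.ball (0 : ℂ) r → Surface)
    (hc : Continuous c)
    (hz : ∀ (p : polygon) (ζ : Metric.ball (0 : ℂ) r), (p : ℂ) = z + ζ → c ζ = proj p)
    (hw : ∀ (p : polygon) (ζ : Metric.ball (0 : ℂ) r), (p : ℂ) = w + ζ → c ζ = proj p)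
    (hp : ∀ (p : polygon) (ζ : Metric.ball (0 : ℂ) r), proj p = c ζ →
      (p : ℂ) = z + ζ ∨ (p : ℂ) = w + ζ)
    (hzw : z = w ∨ 2 * r ≤ ‖z - w‖) :
    ∃ e : OpenPartialHomeomorph Surface ℂ, IsCanonicalChart e ∧ e.source = Set.range c := by
  have hinj : Function.Injective c := by
    intro ζ ζ' h
    obtain ⟨p, hpc⟩ := surjective_proj (c ζ)
    have h₁ := hp p ζ hpc
    have h₂ := hp p ζ' (hpc.trans h)
    have b₁ : ‖(ζ : ℂ)‖ < r := mem_ball_zero_iff.1 ζ.2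
    have b₂ : ‖(ζ' : ℂ)‖ < r := mem_ball_zero_iff.1 ζ'.2
    apply Subtype.ext
    have far : ∀ a b : ℂ, ‖a‖ < r → ‖b‖ < r → z + a = w + b → a = b := by
      intro a b ha hb hab
      rcases hzw with rfl | hzw
      · exact add_left_cancel hab
      · exfalso
        have : z - w = b - a := by linear_combination hab
        rw [this] at hzw
        linarith [norm_sub_le b a]
    rcases h₁ with h₁ | h₁ <;> rcases h₂ with h₂ | h₂ <;> rw [h₁] at h₂
    · exact add_left_cancel h₂
    · exact far _ _ b₁ b₂ h₂
    · exact (far _ _ b₂ b₁ h₂.symm).symm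
    · exact add_left_cancel h₂
  have hopen : IsOpenMap c := by
    intro V hV
    obtain ⟨V', hV', rfl⟩ := hV.mono (le_refl _)
    have hV₂ : IsOpen (V' ∩ Metric.ball 0 r) := hV'.inter Metric.isOpen_ball
    have : proj ⁻¹' (c '' (Subtype.val ⁻¹' V')) =
        (fun p : polygon => (p : ℂ) - z) ⁻¹' (V' ∩ Metric.ball 0 r) ∪
        (fun p : polygon => (p : ℂ) - w) ⁻¹' (V' ∩ Metric.ball 0 r) := by
      ext p
      constructor
      · rintro ⟨ζ, hζ, h⟩
        rcases hp p ζ h.symm with h | h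
        · left; simp only [Set.mem_preimage, h, add_sub_cancel_left]; exact ⟨hζ, ζ.2⟩
        · right; simp only [Set.mem_preimage, h, add_sub_cancel_left]; exact ⟨hζ, ζ.2⟩
      · rintro (⟨h₁, h₂⟩ | ⟨h₁, h₂⟩)
        · exact ⟨⟨_, h₂⟩, h₁, hz _ _ (by simp)⟩
        · exact ⟨⟨_, h₂⟩, h₁, hw _ _ (by simp)⟩
    rw [isOpen_surface_iff, this]
    exact (hV₂.preimage (by fun_prop)).union (hV₂.preimage (by fun_prop))
  have hemb := Topology.IsOpenEmbedding.of_continuous_injective_isOpenMap hc hinj hopen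
  have hsub : Topology.IsOpenEmbedding (Subtype.val : Metric.ball (0 : ℂ) r → ℂ) :=
    Metric.isOpen_ball.isOpenEmbedding_subtypeVal
  have : Nonempty (Metric.ball (0 : ℂ) r) := ⟨⟨0, by simpa using hr⟩⟩
  let e₁ := hemb.toOpenPartialHomeomorph c
  let e₂ := hsub.toOpenPartialHomeomorph _
  have hsrc : (e₁.symm.trans e₂).source = Set.range c := by
    ext x
    simp [e₁, e₂]
  have heval : ∀ ζ, (e₁.symm.trans e₂) (c ζ) = (ζ : ℂ) := by
    intro ζ
    have : e₁.symm (c ζ) = ζ := e₁.left_inv (x := ζ) (by simp [e₁])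
    simp only [OpenPartialHomeomorph.coe_trans, Function.comp_apply, this]
    rfl
  refine ⟨e₁.symm.trans e₂, ?_, hsrc⟩
  intro p hps
  rw [hsrc] at hps
  obtain ⟨ζ, hζ⟩ := hps
  have near : ∀ v : ℂ, (p : ℂ) = v + ζ →
      (∀ (p : polygon) (ζ : Metric.ball (0 : ℂ) r), (p : ℂ) = v + ζ → c ζ = proj p) →
      ∀ᶠ q in 𝓝 p, (e₁.symm.trans e₂) (proj q) =
        (e₁.symm.trans e₂) (proj p) + ((q : ℂ) - (p : ℂ)) := by
    intro v hv hvc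
    have hcont : Continuous fun q : polygon => (q : ℂ) - v := by fun_prop
    have : ∀ᶠ q : polygon in 𝓝 p, (q : ℂ) - v ∈ Metric.ball (0 : ℂ) r := by
      apply hcont.continuousAt.eventually_mem
      rw [hv, add_sub_cancel_left]
      exact Metric.isOpen_ball.mem_nhds ζ.2
    filter_upwards [this] with q hq
    rw [← hvc q ⟨_, hq⟩ (by simp), ← hζ, heval, heval, hv]
    ring
  rcases hp p ζ hζ.symm with h | h
  · exact near z h hz
  · exact near w h hw

lemma exists_chart_of_mem_interior {p : polygon} (h : (p : ℂ) ∈ polygonInterior) :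
    ∃ e : OpenPartialHomeomorph Surface ℂ, IsCanonicalChart e ∧ proj p ∈ e.source := by
  obtain ⟨r, hr, hb⟩ := Metric.isOpen_iff.1 isOpen_polygonInterior p h
  have hmem : ∀ ζ : Metric.ball (0 : ℂ) r, (p : ℂ) + ζ ∈ polygonInterior := by
    intro ζ
    apply hb
    rw [mem_ball_iff_norm, add_sub_cancel_left]
    exact mem_ball_zero_iff.1 ζ.2
  let c : Metric.ball (0 : ℂ) r → Surface :=
    fun ζ => proj ⟨p + ζ, polygonInterior_subset (hmem ζ)⟩
  have hc : Continuous c := continuous_proj.comp (by fun_prop)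
  have hz : ∀ (q : polygon) (ζ : Metric.ball (0 : ℂ) r), (q : ℂ) = p + ζ → c ζ = proj q := by
    intro q ζ hq
    exact congrArg proj (Subtype.ext hq.symm)
  obtain ⟨e, he, hs⟩ := exists_chart_of_param hr c hc hz hz (by
    intro q ζ hq
    rcases proj_eq_iff.1 hq with h | h | h
    · exact Or.inl (congrArg Subtype.val h)
    · exact absurd (hmem ζ) h.right_notMem
    · exact absurd (hmem ζ) h.left_notMem) (Or.inl rfl)
  refine ⟨e, he, hs ▸ ⟨⟨0, by simpa using hr⟩, hz _ _ (by simp)⟩⟩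

lemma exists_chart_of_glue {p q : polygon} (h : Glue p q) :
    ∃ e : OpenPartialHomeomorph Surface ℂ, IsCanonicalChart e ∧ proj p ∈ e.source := by
  classical
  obtain ⟨L, r, hL, hL₀, hr, hr', hloc⟩ := h.exists_halfDiscs
  have hmz : ∀ ζ : ℂ, ‖ζ‖ < r → L ζ ≤ 0 → (p : ℂ) + ζ ∈ polygon := by
    intro ζ hζ h
    rcases h.lt_or_eq with h | h
    · exact polygonInterior_subset ((hloc ζ hζ).1 h).1
    · exact ((hloc ζ hζ).2.1 h).left_mem
  have hmw : ∀ ζ : ℂ, ‖ζ‖ < r → 0 ≤ L ζ → (q : ℂ) + ζ ∈ polygon := by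
    intro ζ hζ h
    rcases h.lt_or_eq with h | h
    · exact polygonInterior_subset ((hloc ζ hζ).2.2 h).1
    · exact ((hloc ζ hζ).2.1 h.symm).right_mem
  -- the projection, extended to the whole plane by a constant
  let f : ℂ → Surface := fun a => if h : a ∈ polygon then proj ⟨a, h⟩ else proj p
  have hf : ∀ a : polygon, f a = proj a := fun a => dif_pos a.2
  have hfc : ContinuousOn f polygon := by
    rw [continuousOn_iff_continuous_domRestrict]
    convert continuous_proj using 1
    funext a
    exact hf a
  let c : Metric.ball (0 : ℂ) r → Surface :=
    fun ζ => if L ζ ≤ 0 then f (p + ζ) else f (q + ζ)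
  have hnorm : ∀ ζ : Metric.ball (0 : ℂ) r, ‖(ζ : ℂ)‖ < r := fun ζ => mem_ball_zero_iff.1 ζ.2
  have hglue : ∀ ζ : Metric.ball (0 : ℂ) r, L ζ = 0 → f (p + ζ) = f (q + ζ) := by
    intro ζ h₀
    have hg := (hloc ζ (hnorm ζ)).2.1 h₀
    rw [hf ⟨_, hg.left_mem⟩, hf ⟨_, hg.right_mem⟩]
    exact proj_eq_iff.2 (Or.inr (Or.inl hg))
  have hc : Continuous c := by
    refine continuous_if_le (hL.comp continuous_subtype_val) continuous_const ?_ ?_ hglue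
    · exact hfc.comp (by fun_prop) fun ζ h => hmz ζ (hnorm ζ) h
    · exact hfc.comp (by fun_prop) fun ζ h => hmw ζ (hnorm ζ) h
  have hz : ∀ (a : polygon) (ζ : Metric.ball (0 : ℂ) r), (a : ℂ) = p + ζ → c ζ = proj a := by
    intro a ζ ha
    have hle : L ζ ≤ 0 := by
      by_contra hlt
      exact ((hloc ζ (hnorm ζ)).2.2 (not_le.1 hlt)).2 (ha ▸ a.2)
    simp only [c, hle, if_true, ← ha, hf]
  have hw : ∀ (a : polygon) (ζ : Metric.ball (0 : ℂ) r), (a : ℂ) = q + ζ → c ζ = proj a := by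
    intro a ζ ha
    rcases lt_trichotomy (L ζ) 0 with h | h | h
    · exact absurd (ha ▸ a.2) ((hloc ζ (hnorm ζ)).1 h).2
    · simp only [c, h.le, if_true, hglue ζ h, ← ha, hf]
    · simp only [c, not_le.2 h, if_false, ← ha, hf]
  obtain ⟨e, he, hs⟩ := exists_chart_of_param hr c hc hz hw (by
    intro a ζ ha
    rcases lt_trichotomy (L ζ) 0 with h | h | h
    · have hm := ((hloc ζ (hnorm ζ)).1 h).1
      rw [hz ⟨_, polygonInterior_subset hm⟩ ζ rfl] at ha
      rcases proj_eq_iff.1 ha with h' | h' | h'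
      · exact Or.inl (congrArg Subtype.val h')
      · exact absurd hm h'.right_notMem
      · exact absurd hm h'.left_notMem
    · have hg := (hloc ζ (hnorm ζ)).2.1 h
      rw [hz ⟨_, hg.left_mem⟩ ζ rfl] at ha
      rcases proj_eq_iff.1 ha with h' | h' | h'
      · exact Or.inl (congrArg Subtype.val h')
      · exact absurd hg h'.not_chain
      · exact Or.inr (h'.functional hg)
    · have hm := ((hloc ζ (hnorm ζ)).2.2 h).1
      rw [hw ⟨_, polygonInterior_subset hm⟩ ζ rfl] at ha
      rcases proj_eq_iff.1 ha with h' | h' | h'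
      · exact Or.inr (congrArg Subtype.val h')
      · exact absurd hm h'.right_notMem
      · exact absurd hm h'.left_notMem)
    (Or.inr (by linarith [h.half_le_norm_sub]))
  refine ⟨e, he, hs ▸ ⟨⟨0, by simpa using hr⟩, hz _ _ (by simp)⟩⟩

/-- Every point of the surface is in the domain of a canonical chart. -/
lemma exists_canonicalChart (x : Surface) :
    ∃ e : OpenPartialHomeomorph Surface ℂ, IsCanonicalChart e ∧ x ∈ e.source := by
  obtain ⟨p, rfl⟩ := surjective_proj x
  rcases p.2 with h | ⟨w, h | h⟩
  · exact exists_chart_of_mem_interior h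
  · exact exists_chart_of_glue (q := ⟨w, h.right_mem⟩) h
  · have e : proj ⟨w, h.left_mem⟩ = proj p := proj_eq_iff.2 (Or.inr (Or.inl h))
    exact e ▸ exists_chart_of_glue (p := ⟨w, h.left_mem⟩) (q := p) h

/-- Two canonical charts differ, locally, by a translation. -/
lemma IsCanonicalChart.eventually_eq {e e' : OpenPartialHomeomorph Surface ℂ}
    (he : IsCanonicalChart e) (he' : IsCanonicalChart e') {x : Surface} (hx : x ∈ e.source)
    (hx' : x ∈ e'.source) : ∀ᶠ y in 𝓝 x, e' y = e' x + (e y - e x) := by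
  have hopen : IsOpen {y | y ∈ e.source ∧ y ∈ e'.source ∧ e' y = e' x + (e y - e x)} := by
    rw [isOpen_surface_iff, isOpen_iff_mem_nhds]
    rintro p ⟨hp, hp', hpe⟩
    filter_upwards [he p hp, he' p hp',
      continuous_proj.continuousAt.eventually_mem (e.open_source.mem_nhds hp),
      continuous_proj.continuousAt.eventually_mem (e'.open_source.mem_nhds hp')] with q h₁ h₂ h₃ h₄
    refine ⟨h₃, h₄, ?_⟩
    rw [h₁, h₂, hpe]
    ring
  filter_upwards [hopen.mem_nhds ⟨hx, hx', by ring⟩] with y hy using hy.2.2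

/-- The atlas of `X_∞` consists of the canonical charts of `ω_∞`. -/
instance : ChartedSpace ℂ Surface where
  atlas := {e | IsCanonicalChart e}
  chartAt x := (exists_canonicalChart x).choose
  mem_chart_source x := (exists_canonicalChart x).choose_spec.2
  chart_mem_atlas x := (exists_canonicalChart x).choose_spec.1

/-- With this atlas, `X_∞` is a complex manifold of dimension one. -/
instance : IsManifold 𝓘(ℂ) ω Surface := by
  apply isManifold_of_contDiffOn
  intro e e' he he'
  simp only [modelWithCornersSelf_coe, modelWithCornersSelf_coe_symm, Function.comp_id,
    Function.id_comp, Set.preimage_id, Set.range_id, Set.inter_univ]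
  intro a ha
  have ha₁ : a ∈ e.target := ha.1
  have ha₂ : e.symm a ∈ e'.source := ha.2
  have h := IsCanonicalChart.eventually_eq he he' (e.map_target ha₁) ha₂
  have h' : ∀ᶠ b in 𝓝 a, (e.symm.trans e') b = e' (e.symm a) + (b - a) := by
    filter_upwards [(e.continuousAt_symm ha₁).eventually h, e.open_target.mem_nhds ha₁] with b hb hb'
    rw [e.right_inv hb', e.right_inv ha₁] at hb
    exact hb
  have hs : ContDiffAt ℂ ω (fun b => e' (e.symm a) + (b - a)) a := by fun_prop
  exact (hs.congr_of_eventuallyEq h').contDiffWithinAt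

/-! ### Affine homeomorphisms and directions -/

/-- Read in canonical charts around `x` and `φ x`, the map `φ` is affine near `x`, with linear part
`A`. -/
def HasAffineDerivAt (φ : Surface → Surface) (A : ℂ ≃ₗ[ℝ] ℂ) (x : Surface) : Prop :=
  ∀ e ∈ atlas ℂ Surface, ∀ e' ∈ atlas ℂ Surface, x ∈ e.source → φ x ∈ e'.source →
    ∀ᶠ y in 𝓝 x, e' (φ y) = e' (φ x) + A (e y - e x)

/-- The homeomorphism `φ` is affine, i.e. it belongs to `Aff(X_∞, ω_∞)`: in the canonical charts of
`ω_∞`, it is affine near every point. -/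
def IsAffine (φ : Surface ≃ₜ Surface) : Prop :=
  ∀ x, ∃ A : ℂ ≃ₗ[ℝ] ℂ, HasAffineDerivAt φ A x

/-- The vertical direction. Directions are the points of the real projective line `ℙ ℝ ℂ`, each of
which has its foliation of `X_∞` by parallel straight lines. -/
def vertical : ℙ ℝ ℂ := Projectivization.mk ℝ Complex.I Complex.I_ne_zero

/-- The affine homeomorphism `φ` sends the direction `θ` to the direction `θ'`: at every point, the
derivative of `φ` maps the line `θ` to the line `θ'`. -/
def SendsDirection (φ : Surface ≃ₜ Surface) (θ θ' : ℙ ℝ ℂ) : Prop :=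
  ∀ (x : Surface) (A : ℂ ≃ₗ[ℝ] ℂ), HasAffineDerivAt φ A x →
    Projectivization.map (A : ℂ →ₗ[ℝ] ℂ) A.injective θ = θ'

end ArnouxYoccoz

end

/-! The vertical direction is distinguished by the way in which the removed endpoints of edges
accumulate. To the right of the point `(0, 2/3)` the polygon contains a half disc with vertical
diameter, and endpoints of copies of the `A n` and of the `B n` converge to its centre along the
diameter from below and from above (`frequently_notMem_polygon`).

Suppose that `φ` sends a non-vertical `θ` to the vertical direction. Read through the derivative `A`
of `φ`, the preimage of this half disc is a translation into the surface, defined on a half disc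
whose boundary line is `θ` (`IsTranslationOn.symm_comp`). Along the right half of a non-vertical
boundary line, close to the centre, such a translation always has limits in the surface
(`eventually_exists_tendsto`). Since `A` maps that half line onto one half of the vertical diameter,
applying `φ` gives limits in the surface at endpoints of edges. By `liesOver_of_tendsto` such
endpoints would belong to the polygon, a contradiction.

The limits exist for the following reason. In a small half disc, all preimages of left edges have
the same abscissa and all preimages of bottom edges the same height, because two different lines
would be at least 1, respectively 1/2, apart. After shrinking, these preimages lie on the axes
(`exists_edges_subset_axes`). A sector next to the right half of the boundary line thus avoids all
edges and lifts to a translation into the interior of the polygon, so the boundary ray is carried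
into the closed polygon. A slanted ray immediately leaves the lines that contain the sides. A
horizontal one may run along a side, but endpoints on the top and the bottom accumulate only at the
right end, so that an open edge begins to the right of every other point (`eventually_ray_mem`). -/

namespace ArnouxYoccoz

open Filter Set

/-! ### Points of the polygon over a point of the surface -/

/-- The point `a` of the plane lies in the polygon and projects to the point `x` of the surface. -/
def LiesOver (a : ℂ) (x : Surface) : Prop := ∃ p : polygon, (p : ℂ) = a ∧ proj p = x

lemma LiesOver.mem {a : ℂ} {x : Surface} (h : LiesOver a x) : a ∈ polygon := by
  obtain ⟨p, rfl, -⟩ := h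
  exact p.2

lemma LiesOver.eq_or_glue {a b : ℂ} {x : Surface} (ha : LiesOver a x) (hb : LiesOver b x) :
    a = b ∨ Glue a b ∨ Glue b a := by
  obtain ⟨p, rfl, rfl⟩ := ha
  obtain ⟨q, rfl, h⟩ := hb
  rcases proj_eq_iff.1 h.symm with rfl | h | h
  · exact Or.inl rfl
  · exact Or.inr (Or.inl h)
  · exact Or.inr (Or.inr h)

lemma LiesOver.eq_of_mem_interior {a b : ℂ} {x : Surface} (ha : LiesOver a x)
    (hb : LiesOver b x) (h : a ∈ polygonInterior) : a = b := by
  rcases ha.eq_or_glue hb with h' | h' | h'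
  · exact h'
  · exact absurd h h'.left_notMem
  · exact absurd h h'.right_notMem

lemma Glue.liesOver_left {z w : ℂ} (h : Glue z w) {x : Surface} (hw : LiesOver w x) :
    LiesOver z x := by
  obtain ⟨p, rfl, rfl⟩ := hw
  exact ⟨⟨z, h.left_mem⟩, rfl, proj_eq_iff.2 (Or.inr (Or.inl h))⟩

lemma Glue.liesOver_right {z w : ℂ} (h : Glue z w) {x : Surface} (hz : LiesOver z x) :
    LiesOver w x := by
  obtain ⟨p, rfl, rfl⟩ := hz
  exact ⟨⟨w, h.right_mem⟩, rfl, proj_eq_iff.2 (Or.inr (Or.inr h))⟩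

lemma exists_liesOver (x : Surface) : ∃ a, LiesOver a x := by
  obtain ⟨p, rfl⟩ := surjective_proj x
  exact ⟨p, p, rfl, rfl⟩

/-- This transfers the defining property of a canonical chart from the subtype `polygon` to
neighbourhoods in the plane, where displacements can be compared without membership proofs. -/
lemma IsCanonicalChart.eventually_of_liesOver {e : OpenPartialHomeomorph Surface ℂ}
    (he : IsCanonicalChart e) {a : ℂ} {x : Surface} (hx : x ∈ e.source) (ha : LiesOver a x) :
    ∀ᶠ b in 𝓝 a, ∀ y, LiesOver b y → y ∈ e.source ∧ e y = e x + (b - a) := by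
  obtain ⟨p, rfl, rfl⟩ := ha
  have h := (he p hx).and
    (continuous_proj.continuousAt.eventually_mem (e.open_source.mem_nhds hx))
  rw [nhds_subtype_eq_comap, eventually_comap] at h
  filter_upwards [h] with b hb y hy
  obtain ⟨q, rfl, rfl⟩ := hy
  exact (hb q rfl).symm

/-- Near a point of the surface, the polygon consists of pieces around at most two points. -/
lemma exists_local_pieces (x : Surface) : ∃ a b : ℂ, LiesOver a x ∧ LiesOver b x ∧
    ∀ᶠ ζ in 𝓝 (0 : ℂ), ∃ d y, (d = a ∨ d = b) ∧ LiesOver (d + ζ) y ∧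
      ∀ q, LiesOver q y → q = a + ζ ∨ q = b + ζ := by
  have key : ∀ z w : ℂ, Glue z w → LiesOver z x → ∃ a b : ℂ, LiesOver a x ∧ LiesOver b x ∧
    ∀ᶠ ζ in 𝓝 (0 : ℂ), ∃ d y, (d = a ∨ d = b) ∧ LiesOver (d + ζ) y ∧
      ∀ q, LiesOver q y → q = a + ζ ∨ q = b + ζ := by
    intro z w h hz
    refine ⟨z, w, hz, h.liesOver_right hz, ?_⟩
    obtain ⟨L, r, -, -, hr, -, hloc⟩ := h.exists_halfDiscs
    filter_upwards [Metric.ball_mem_nhds (0 : ℂ) hr] with ζ hζ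
    obtain ⟨h₁, h₂, h₃⟩ := hloc ζ (mem_ball_zero_iff.1 hζ)
    rcases lt_trichotomy (L ζ) 0 with hL | hL | hL
    · have hm := (h₁ hL).1
      have ho : LiesOver (z + ζ) (proj ⟨_, polygonInterior_subset hm⟩) := ⟨_, rfl, rfl⟩
      exact ⟨z, _, Or.inl rfl, ho, fun q hq => Or.inl (ho.eq_of_mem_interior hq hm).symm⟩
    · have hg := h₂ hL
      have ho : LiesOver (z + ζ) (proj ⟨_, hg.left_mem⟩) := ⟨_, rfl, rfl⟩
      refine ⟨z, _, Or.inl rfl, ho, fun q hq => ?_⟩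
      rcases ho.eq_or_glue hq with h' | h' | h'
      · exact Or.inl h'.symm
      · exact Or.inr (h'.functional hg)
      · exact absurd hg h'.not_chain
    · have hm := (h₃ hL).1
      have ho : LiesOver (w + ζ) (proj ⟨_, polygonInterior_subset hm⟩) := ⟨_, rfl, rfl⟩
      exact ⟨w, _, Or.inr rfl, ho, fun q hq => Or.inr (ho.eq_of_mem_interior hq hm).symm⟩
  obtain ⟨p, rfl⟩ := surjective_proj x
  have hp : LiesOver p (proj p) := ⟨p, rfl, rfl⟩
  rcases p.2 with h | ⟨w, h | h⟩
  · refine ⟨p, p, hp, hp, ?_⟩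
    have : ∀ᶠ ζ in 𝓝 (0 : ℂ), (p : ℂ) + ζ ∈ polygonInterior := by
      have hc : ContinuousAt (fun ζ : ℂ => (p : ℂ) + ζ) 0 := by fun_prop
      exact hc.eventually_mem (isOpen_polygonInterior.mem_nhds (by simpa using h))
    filter_upwards [this] with ζ hm
    have ho : LiesOver (p + ζ) (proj ⟨_, polygonInterior_subset hm⟩) := ⟨_, rfl, rfl⟩
    exact ⟨p, _, Or.inl rfl, ho, fun q hq => Or.inl (ho.eq_of_mem_interior hq hm).symm⟩
  · exact key _ _ h hp
  · exact key _ _ h (h.liesOver_left hp)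

/-- Near `x`, all points of the polygon over points of the surface are close to the points over
`x`. -/
lemma eventually_liesOver_mem (x : Surface) : ∃ a b : ℂ, LiesOver a x ∧ LiesOver b x ∧
    ∀ U ∈ 𝓝 a, ∀ V ∈ 𝓝 b, ∀ᶠ y in 𝓝 x, ∀ q, LiesOver q y → q ∈ U ∪ V := by
  obtain ⟨a, b, ha, hb, hloc⟩ := exists_local_pieces x
  refine ⟨a, b, ha, hb, fun U hU V hV => ?_⟩
  obtain ⟨e, he, hx⟩ := exists_canonicalChart x
  have hadd : ∀ d : ℂ, Tendsto (fun ζ : ℂ => d + ζ) (𝓝 0) (𝓝 d) := fun d => by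
    have : ContinuousAt (fun ζ : ℂ => d + ζ) 0 := by fun_prop
    simpa [ContinuousAt] using this
  have hsub : Tendsto (fun y => e y - e x) (𝓝 x) (𝓝 0) := by
    simpa using (e.continuousAt hx).tendsto.sub_const (e x)
  filter_upwards [hsub.eventually (hloc.and (((hadd a).eventually hU).and
    (((hadd b).eventually hV).and (((hadd a).eventually (he.eventually_of_liesOver hx ha)).and
      ((hadd b).eventually (he.eventually_of_liesOver hx hb)))))),
    e.open_source.mem_nhds hx] with y hy hys q hq
  obtain ⟨⟨d, y', hd, hdy, hreps⟩, hUa, hVb, hca, hcb⟩ := hy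
  -- The local pieces are indexed by the displacement `ζ = e y - e x`. The point `y'` that they
  -- provide has the same chart coordinate as `y`, so the two agree.
  have hy' : y' ∈ e.source ∧ e y' = e y := by
    rcases hd with rfl | rfl
    · have := hca _ hdy
      exact ⟨this.1, by rw [this.2]; ring⟩
    · have := hcb _ hdy
      exact ⟨this.1, by rw [this.2]; ring⟩
  obtain rfl := e.injOn hy'.1 hys hy'.2
  rcases hreps q hq with rfl | rfl
  · exact Or.inl hUa
  · exact Or.inr hVb

/-- If points of the polygon converge in the plane and their projections converge in the surface,
then the limit in the plane belongs to the polygon and lies over the limit in the surface. -/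
lemma liesOver_of_tendsto {α : Type*} {l : Filter α} [l.NeBot] {f : α → ℂ} {g : α → Surface}
    {a : ℂ} {x : Surface} (hfg : ∀ᶠ i in l, LiesOver (f i) (g i)) (hf : Tendsto f l (𝓝 a))
    (hg : Tendsto g l (𝓝 x)) : LiesOver a x := by
  obtain ⟨b, c, hb, hc, h⟩ := eventually_liesOver_mem x
  by_contra ha
  have hab : a ≠ b := by rintro rfl; exact ha hb
  have hac : a ≠ c := by rintro rfl; exact ha hc
  obtain ⟨U, hU, V, hV, hUV⟩ := Filter.disjoint_iff.1 (disjoint_nhds_nhds.2 hab)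
  obtain ⟨U', hU', V', hV', hUV'⟩ := Filter.disjoint_iff.1 (disjoint_nhds_nhds.2 hac)
  -- Every point over `g i` is eventually near `b` or near `c`, while `f i` stays near `a`, which is
  -- separated from both.
  obtain ⟨i, h₁, h₂, h₃, h₄⟩ := ((hg.eventually (h V hV V' hV')).and
    ((hf.eventually hU).and ((hf.eventually hU').and hfg))).exists
  rcases h₁ _ h₄ with h' | h'
  · exact hUV.le_bot ⟨h₂, h'⟩
  · exact hUV'.le_bot ⟨h₃, h'⟩

/-! ### Translations into the surface -/

/-- In canonical charts, the map `ι` is a translation near every point of `D`. -/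
def IsTranslationOn (ι : ℂ → Surface) (D : Set ℂ) : Prop :=
  ∀ z ∈ D, ContinuousAt ι z ∧ ∀ e : OpenPartialHomeomorph Surface ℂ, IsCanonicalChart e →
    ι z ∈ e.source → ∀ᶠ w in 𝓝 z, e (ι w) = e (ι z) + (w - z)

lemma IsTranslationOn.mono {ι : ℂ → Surface} {D D' : Set ℂ} (h : IsTranslationOn ι D)
    (hD : D' ⊆ D) : IsTranslationOn ι D' := fun z hz => h z (hD hz)

/-- Lifting of a translation into the surface to a subset `E` of the polygon. -/
lemma IsTranslationOn.lift {ι : ℂ → Surface} {K E : Set ℂ} (hι : IsTranslationOn ι K)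
    (hK : IsPreconnected K) (hE : ∀ a ∈ closure E, a ∈ polygon → a ∈ E) {c z₀ : ℂ} (hz₀ : z₀ ∈ K)
    (h₀ : c + z₀ ∈ E) (h₀' : LiesOver (c + z₀) (ι z₀))
    (hopen : ∀ z ∈ K, c + z ∈ E → LiesOver (c + z) (ι z) →
      ∀ᶠ w in 𝓝[K] z, c + w ∈ E ∧ c + w ∈ polygon) :
    ∀ z ∈ K, c + z ∈ E ∧ LiesOver (c + z) (ι z) := by
  have : PreconnectedSpace K := Subtype.preconnectedSpace hK
  let S : Set K := {z | c + (z : ℂ) ∈ E ∧ LiesOver (c + z) (ι z)}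
  -- Closedness comes from `liesOver_of_tendsto` and `hE`. For openness, `ι` and the projection of
  -- `c + w` have the same coordinate in one chart around `ι z`.
  have hcl : IsClopen S := by
    constructor
    · rw [isClosed_iff_frequently]
      intro z hz
      have hne : (𝓝 z ⊓ 𝓟 S).NeBot :=
        frequently_mem_iff_neBot.1 hz
      have hf : Tendsto (fun w : K => c + (w : ℂ))
          (𝓝 z ⊓ 𝓟 S) (𝓝 (c + z)) :=
        (Continuous.tendsto (by fun_prop) z).mono_left inf_le_left
      have hg : Tendsto (fun w : K => ι w)
          (𝓝 z ⊓ 𝓟 S) (𝓝 (ι z)) :=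
        ((hι z z.2).1.tendsto.comp continuous_subtype_val.continuousAt).mono_left inf_le_left
      have hev : ∀ᶠ w : K in 𝓝 z ⊓ 𝓟 S,
          c + (w : ℂ) ∈ E ∧ LiesOver (c + w) (ι w) := mem_inf_of_right (mem_principal_self _)
      have ho := liesOver_of_tendsto (hev.mono fun _ h => h.2) hf hg
      exact ⟨hE _ (mem_closure_of_tendsto hf (hev.mono fun _ h => h.1)) ho.mem, ho⟩
    · rw [isOpen_iff_mem_nhds]
      rintro z ⟨hz, hz'⟩
      obtain ⟨e, he, hx⟩ := exists_canonicalChart (ι z)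
      obtain ⟨hc, ht⟩ := hι z z.2
      have hadd : Tendsto (fun w : ℂ => c + w) (𝓝 z) (𝓝 (c + z)) :=
        Continuous.tendsto (by fun_prop) _
      have h₁ := hopen z z.2 hz hz'
      rw [← map_nhds_subtype_val, eventually_map] at h₁
      have h₂ := continuous_subtype_val.continuousAt.eventually ((ht e he hx).and
        ((hc.eventually_mem (e.open_source.mem_nhds hx)).and
          (hadd.eventually (he.eventually_of_liesOver hx hz'))))
      filter_upwards [h₁, h₂] with w ⟨hwE, hwp⟩ ⟨hw₁, hw₂, hw₃⟩
      have ho : LiesOver (c + w) (proj ⟨_, hwp⟩) := ⟨_, rfl, rfl⟩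
      obtain ⟨hs, hv⟩ := hw₃ _ ho
      have : proj ⟨_, hwp⟩ = ι w := by
        apply e.injOn hs hw₂
        rw [hv, hw₁]
        ring
      exact ⟨hwE, this ▸ ho⟩
  have hS : S = univ := hcl.eq_univ ⟨⟨z₀, hz₀⟩, h₀, h₀'⟩
  intro z hz
  have hm : (⟨z, hz⟩ : K) ∈ S := hS ▸ mem_univ _
  exact hm

/-! ### The edges -/

/-- The vertical edges on the left sides of the two rectangles. -/
def leftEdges : Set ℂ :=
  {w | (∃ z, Glue z w) ∧ (w.re = 0 ∧ 1 / 2 < w.im ∨ w.re = -1 / 2)}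

/-- The horizontal edges on the bottom sides of the two rectangles. -/
def bottomEdges : Set ℂ :=
  {w | (∃ z, Glue z w) ∧ (w.im = 0 ∨ w.im = 1 / 2 ∧ 1 / 2 < w.re)}

lemma leftEdges_subset : leftEdges ⊆ polygon := fun _ ⟨⟨_, h⟩, _⟩ => h.right_mem

lemma bottomEdges_subset : bottomEdges ⊆ polygon := fun _ ⟨⟨_, h⟩, _⟩ => h.right_mem

lemma notMem_interior_of_mem_leftEdges {w : ℂ} (h : w ∈ leftEdges) : w ∉ polygonInterior := by
  obtain ⟨⟨z, h⟩, -⟩ := h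
  exact h.right_notMem

lemma notMem_interior_of_mem_bottomEdges {w : ℂ} (h : w ∈ bottomEdges) :
    w ∉ polygonInterior := by
  obtain ⟨⟨z, h⟩, -⟩ := h
  exact h.right_notMem

/-- Both rectangles have width 1. -/
lemma add_mem_interior_of_mem_leftEdges {w : ℂ} (h : w ∈ leftEdges) {t : ℝ} (h₀ : 0 < t)
    (h₁ : t < 1) : w + t ∈ polygonInterior := by
  obtain ⟨⟨z, h⟩, hw⟩ := h
  rcases h.right with h | h | h | h
  · apply mem_upper <;> simp <;> linarith [h.1, h.2.1, h.2.2]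
  · apply mem_lower <;> simp <;> linarith [h.1, h.2.1, h.2.2]
  · exfalso; rcases hw with ⟨hw, _⟩ | hw <;> linarith [h.1, h.2.2]
  · exfalso; rcases hw with ⟨hw, _⟩ | hw <;> linarith [h.1, h.2.2]

/-- Both rectangles have height 1/2. -/
lemma add_mem_interior_of_mem_bottomEdges {w : ℂ} (h : w ∈ bottomEdges) {t : ℝ} (h₀ : 0 < t)
    (h₁ : t < 1 / 2) : w + t * Complex.I ∈ polygonInterior := by
  obtain ⟨⟨z, h⟩, hw⟩ := h
  rcases h.right with h | h | h | h
  · exfalso; rcases hw with hw | ⟨hw, _⟩ <;> linarith [h.1, h.2.1]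
  · exfalso; rcases hw with hw | ⟨hw, _⟩ <;> linarith [h.1, h.2.1]
  · apply mem_lower <;> simp <;> linarith [h.1, h.2.1, h.2.2]
  · apply mem_upper <;> simp <;> linarith [h.1, h.2.1, h.2.2]

/-- A point of the surface lies under the interior of the polygon or under one of the edges. -/
lemma LiesOver.cases {a : ℂ} {x : Surface} (h : LiesOver a x) :
    a ∈ polygonInterior ∨ (∃ w ∈ leftEdges, LiesOver w x) ∨ ∃ w ∈ bottomEdges, LiesOver w x := by
  have key : ∀ z w, Glue z w → LiesOver w x →
      (∃ w ∈ leftEdges, LiesOver w x) ∨ ∃ w ∈ bottomEdges, LiesOver w x := by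
    intro z w hg hw
    rcases hg.right with h' | h' | h' | h'
    · exact Or.inl ⟨w, ⟨⟨z, hg⟩, Or.inl ⟨h'.1, h'.2.1⟩⟩, hw⟩
    · exact Or.inl ⟨w, ⟨⟨z, hg⟩, Or.inr h'.1⟩, hw⟩
    · exact Or.inr ⟨w, ⟨⟨z, hg⟩, Or.inl h'.2.2⟩, hw⟩
    · exact Or.inr ⟨w, ⟨⟨z, hg⟩, Or.inr ⟨h'.2.2, h'.1⟩⟩, hw⟩
  rcases h.mem with h' | ⟨w, h' | h'⟩
  · exact Or.inl h'
  · exact Or.inr (key _ _ h' (h'.liesOver_right h))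
  · exact Or.inr (key _ _ h' h)

/-- A limit of left edges lies on the closed left sides, where the only points of the polygon are
those of the edges themselves: the endpoints and their limits have been removed. This is the
closedness required by `IsTranslationOn.lift`. -/
lemma mem_leftEdges_of_mem_closure {a : ℂ} (h : a ∈ closure leftEdges) (ha : a ∈ polygon) :
    a ∈ leftEdges := by
  have hc : IsClosed {w : ℂ | w.re = 0 ∧ 1 / 2 ≤ w.im ∨ w.re = -1 / 2} :=
    ((isClosed_eq Complex.continuous_re continuous_const).inter
      (isClosed_le continuous_const Complex.continuous_im)).union
      (isClosed_eq Complex.continuous_re continuous_const)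
  have hm : a.re = 0 ∧ 1 / 2 ≤ a.im ∨ a.re = -1 / 2 :=
    closure_minimal (fun w hw => hw.2.imp_left fun h => ⟨h.1, h.2.le⟩) hc h
  rcases ha with h' | ⟨w, h' | h'⟩
  · exfalso
    rcases h' with h' | h' | h' <;> rcases hm with ⟨hm, _⟩ | hm <;>
      linarith [h'.1, h'.2.1, h'.2.2.1, h'.2.2.2]
  · exfalso
    rcases h'.left with h' | h' | h' | h' <;> rcases hm with ⟨hm, _⟩ | hm <;>
      linarith [h'.1, h'.2.1, h'.2.2]
  · refine ⟨⟨w, h'⟩, ?_⟩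
    rcases h'.right with h' | h' | h' | h'
    · exact Or.inl ⟨h'.1, h'.2.1⟩
    · exact Or.inr h'.1
    · exfalso; rcases hm with ⟨hm, _⟩ | hm <;> linarith [h'.1, h'.2.2]
    · exfalso; rcases hm with ⟨hm, _⟩ | hm <;> linarith [h'.1, h'.2.2]

lemma mem_bottomEdges_of_mem_closure {a : ℂ} (h : a ∈ closure bottomEdges) (ha : a ∈ polygon) :
    a ∈ bottomEdges := by
  have hc : IsClosed {w : ℂ | w.im = 0 ∨ w.im = 1 / 2 ∧ 1 / 2 ≤ w.re} :=
    (isClosed_eq Complex.continuous_im continuous_const).union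
      ((isClosed_eq Complex.continuous_im continuous_const).inter
      (isClosed_le continuous_const Complex.continuous_re))
  have hm : a.im = 0 ∨ a.im = 1 / 2 ∧ 1 / 2 ≤ a.re :=
    closure_minimal (fun w hw => hw.2.imp_right fun h => ⟨h.1, h.2.le⟩) hc h
  rcases ha with h' | ⟨w, h' | h'⟩
  · exfalso
    rcases h' with h' | h' | h' <;> rcases hm with hm | ⟨hm, _⟩ <;>
      linarith [h'.1, h'.2.1, h'.2.2.1, h'.2.2.2]
  · exfalso
    rcases h'.left with h' | h' | h' | h' <;> rcases hm with hm | ⟨hm, _⟩ <;>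
      linarith [h'.1, h'.2.1, h'.2.2]
  · refine ⟨⟨w, h'⟩, ?_⟩
    rcases h'.right with h' | h' | h' | h'
    · exfalso; rcases hm with hm | ⟨hm, _⟩ <;> linarith [h'.1, h'.2.1]
    · exfalso; rcases hm with hm | ⟨hm, _⟩ <;> linarith [h'.1, h'.2.1]
    · exact Or.inl h'.2.2
    · exact Or.inr ⟨h'.2.2, h'.1⟩

lemma eventually_lt_add_lt {a b y : ℝ} (h₁ : a < y) (h₂ : y < b) :
    ∀ᶠ t : ℝ in 𝓝 0, a < y + t ∧ y + t < b := by
  have hc : ContinuousAt (fun t : ℝ => y + t) 0 := by fun_prop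
  exact hc.eventually_mem (Ioo_mem_nhds (by simpa using h₁) (by simpa using h₂))

lemma eventually_add_mem_leftEdges {w : ℂ} (h : w ∈ leftEdges) :
    ∀ᶠ t : ℝ in 𝓝 0, w + t * Complex.I ∈ leftEdges := by
  obtain ⟨⟨z, hg⟩, hw⟩ := h
  have hpos : ∀ᶠ t : ℝ in 𝓝 0, (w + t * Complex.I).re = 0 ∧ 1 / 2 < (w + t * Complex.I).im ∨
      (w + t * Complex.I).re = -1 / 2 := by
    rcases hw with hw | hw
    · filter_upwards [eventually_lt_add_lt hw.2 (lt_add_one _)] with t ht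
      left
      simpa [hw.1] using ht.1
    · refine Eventually.of_forall fun t => Or.inr ?_
      simpa using hw
  refine (Eventually.and ?_ hpos)
  have hr := hg.right
  cases hg with
  | A n y hn h₁ h₂ =>
    filter_upwards [eventually_lt_add_lt h₁ h₂] with t ht
    refine ⟨⟨1, y + t⟩, ?_⟩
    convert Glue.A n (y + t) hn ht.1 ht.2 using 1
    apply Complex.ext <;> simp
    ring
  | B n y hn h₁ h₂ =>
    filter_upwards [eventually_lt_add_lt h₁ h₂] with t ht
    refine ⟨⟨1 / 2, y + t⟩, ?_⟩
    convert Glue.B n (y + t) hn ht.1 ht.2 using 1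
    apply Complex.ext <;> simp
    ring
  | _ =>
    exfalso
    simp only at hw hr
    rcases hr with h | h | h | h <;> rcases hw with ⟨hw, _⟩ | hw <;> linarith [h.1, h.2.1, h.2.2]

lemma eventually_add_mem_bottomEdges {w : ℂ} (h : w ∈ bottomEdges) :
    ∀ᶠ t : ℝ in 𝓝 0, w + t ∈ bottomEdges := by
  obtain ⟨⟨z, hg⟩, hw⟩ := h
  have hpos : ∀ᶠ t : ℝ in 𝓝 0, (w + t).im = 0 ∨ (w + t).im = 1 / 2 ∧ 1 / 2 < (w + t).re := by
    rcases hw with hw | hw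
    · refine Eventually.of_forall fun t => Or.inl ?_
      simpa using hw
    · filter_upwards [eventually_lt_add_lt hw.2 (lt_add_one _)] with t ht
      right
      simpa [hw.1] using ht.1
  refine (Eventually.and ?_ hpos)
  cases hg with
  | C' n x hn h₁ h₂ =>
    filter_upwards [eventually_lt_add_lt h₁ h₂] with t ht
    refine ⟨⟨x + t, 1⟩, ?_⟩
    convert Glue.C' n (x + t) hn ht.1 ht.2 using 1
    apply Complex.ext <;> simp
    ring
  | C'' n x hn h₁ h₂ =>
    filter_upwards [eventually_lt_add_lt h₁ h₂] with t ht
    refine ⟨⟨x + t, 1⟩, ?_⟩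
    convert Glue.C'' n (x + t) hn ht.1 ht.2 using 1
    apply Complex.ext <;> simp
    ring
  | D x h₁ h₂ =>
    filter_upwards [eventually_lt_add_lt h₁ h₂] with t ht
    refine ⟨⟨x + t, 1 / 2⟩, ?_⟩
    convert Glue.D (x + t) ht.1 ht.2 using 1
    apply Complex.ext <;> simp
    ring
  | A n y hn h₁ h₂ =>
    have := half_pow_le hn
    simp only [shift] at hw
    split_ifs at hw <;> rcases hw with hw | ⟨hw, _⟩ <;> linarith
  | B n y hn h₁ h₂ =>
    have := half_pow_le hn
    have := half_pow_pos (n + 1)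
    simp only [shift] at hw
    split_ifs at hw <;> rcases hw with hw | ⟨hw, _⟩ <;> linarith

/-! ### Preimages of the edges under a translation of a convex set -/

variable {ι : ℂ → Surface} {D : Set ℂ} {z z' : ℂ}

/-- A vertical segment that meets a left edge stays on it. The edges are open in the vertical
direction and relatively closed in the polygon, so the segment could leave only through an endpoint,
and endpoints are not in the surface. -/
lemma IsTranslationOn.leftEdges_of_re_eq (hι : IsTranslationOn ι D) (hD : Convex ℝ D)
    (hz : z ∈ D) (hz' : z' ∈ D) (hre : z'.re = z.re) (h : ∃ w ∈ leftEdges, LiesOver w (ι z)) :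
    ∃ w ∈ leftEdges, LiesOver w (ι z') := by
  obtain ⟨w, hw, ho⟩ := h
  have hs : segment ℝ z z' ⊆ {a | a.re = z.re} := by
    refine Convex.segment_subset ?_ rfl hre
    exact convex_hyperplane Complex.reLm.isLinear _
  have hl := (hι.mono (hD.segment_subset hz hz')).lift (convex_segment z z').isPreconnected
    (E := leftEdges) (c := w - z) (fun a => mem_leftEdges_of_mem_closure)
    (left_mem_segment ℝ z z') (by simpa using hw) (by simpa using ho) ?_
  · exact ⟨_, hl z' (right_mem_segment ℝ z z')⟩
  · intro a ha hm _
    have ht : Tendsto (fun b : ℂ => (b - a).im) (𝓝[segment ℝ z z'] a) (𝓝 0) := by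
      have : ContinuousAt (fun b : ℂ => (b - a).im) a := by fun_prop
      simpa [ContinuousAt] using this.tendsto.mono_left nhdsWithin_le_nhds
    filter_upwards [ht.eventually (eventually_add_mem_leftEdges hm), self_mem_nhdsWithin]
      with b hb hbs
    have : w - z + a + ((b - a).im : ℂ) * Complex.I = w - z + b := by
      have h₁ := hs ha
      have h₂ := hs hbs
      simp only [mem_ofPred_eq] at h₁ h₂
      apply Complex.ext <;> simp [h₁, h₂]
    rw [this] at hb
    exact ⟨hb, leftEdges_subset hb⟩

lemma IsTranslationOn.bottomEdges_of_im_eq (hι : IsTranslationOn ι D) (hD : Convex ℝ D)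
    (hz : z ∈ D) (hz' : z' ∈ D) (him : z'.im = z.im) (h : ∃ w ∈ bottomEdges, LiesOver w (ι z)) :
    ∃ w ∈ bottomEdges, LiesOver w (ι z') := by
  obtain ⟨w, hw, ho⟩ := h
  have hs : segment ℝ z z' ⊆ {a | a.im = z.im} := by
    refine Convex.segment_subset ?_ rfl him
    exact convex_hyperplane Complex.imLm.isLinear _
  have hl := (hι.mono (hD.segment_subset hz hz')).lift (convex_segment z z').isPreconnected
    (E := bottomEdges) (c := w - z) (fun a => mem_bottomEdges_of_mem_closure)
    (left_mem_segment ℝ z z') (by simpa using hw) (by simpa using ho) ?_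
  · exact ⟨_, hl z' (right_mem_segment ℝ z z')⟩
  · intro a ha hm _
    have ht : Tendsto (fun b : ℂ => (b - a).re) (𝓝[segment ℝ z z'] a) (𝓝 0) := by
      have : ContinuousAt (fun b : ℂ => (b - a).re) a := by fun_prop
      simpa [ContinuousAt] using this.tendsto.mono_left nhdsWithin_le_nhds
    filter_upwards [ht.eventually (eventually_add_mem_bottomEdges hm), self_mem_nhdsWithin]
      with b hb hbs
    have : w - z + a + ((b - a).re : ℂ) = w - z + b := by
      have h₁ := hs ha
      have h₂ := hs hbs
      simp only [mem_ofPred_eq] at h₁ h₂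
      apply Complex.ext <;> simp [h₁, h₂]
    rw [this] at hb
    exact ⟨hb, bottomEdges_subset hb⟩

/-- A translation along a segment that can be followed inside the polygon. -/
lemma IsTranslationOn.liesOver_segment (hι : IsTranslationOn ι D) (hD : Convex ℝ D)
    (hz : z ∈ D) (hz' : z' ∈ D) {w : ℂ} (hw : LiesOver w (ι z))
    (h : ∀ a ∈ segment ℝ z z', w - z + a ∈ polygon) : LiesOver (w - z + z') (ι z') := by
  refine ((hι.mono (hD.segment_subset hz hz')).lift (convex_segment z z').isPreconnected
    (E := polygon) (c := w - z) (fun a _ h => h)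
    (left_mem_segment ℝ z z') (by simpa using hw.mem) (by simpa using hw) ?_ z'
    (right_mem_segment ℝ z z')).2
  intro a _ _ _
  filter_upwards [self_mem_nhdsWithin] with b hb using ⟨h b hb, h b hb⟩

/-- Moving both points along their edges to the common height `y` puts them on one horizontal
segment. A segment that starts at a left edge and goes right by less than 1 ends in the interior of
the polygon, hence not on an edge. -/
lemma IsTranslationOn.one_le_of_leftEdges (hι : IsTranslationOn ι D) (hD : Convex ℝ D)
    (hz : z ∈ D) (hz' : z' ∈ D) (hlt : z.re < z'.re) (h : ∃ w ∈ leftEdges, LiesOver w (ι z))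
    (h' : ∃ w ∈ leftEdges, LiesOver w (ι z'))
    {y : ℝ} (hy : (⟨z.re, y⟩ : ℂ) ∈ D) (hy' : (⟨z'.re, y⟩ : ℂ) ∈ D) : z.re + 1 ≤ z'.re := by
  by_contra hn
  push Not at hn
  obtain ⟨w, hw, ho⟩ := hι.leftEdges_of_re_eq hD hz hy rfl h
  obtain ⟨w', hw', ho'⟩ := hι.leftEdges_of_re_eq hD hz' hy' rfl h'
  have hs := hι.liesOver_segment hD hy hy' ho (by
    intro a ha
    obtain ⟨t, ⟨ht₀, ht₁⟩, rfl⟩ := (segment_eq_image_lineMap ℝ _ _).subset ha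
    have e : w - ⟨z.re, y⟩ + AffineMap.lineMap (⟨z.re, y⟩ : ℂ) ⟨z'.re, y⟩ t =
        w + ((t * (z'.re - z.re) : ℝ) : ℂ) := by
      apply Complex.ext <;> simp [AffineMap.lineMap_apply]
    rw [e]
    rcases ht₀.eq_or_lt with rfl | ht₀
    · simpa using ho.mem
    · exact polygonInterior_subset (add_mem_interior_of_mem_leftEdges hw (by nlinarith) (by nlinarith)))
  have e : w - ⟨z.re, y⟩ + (⟨z'.re, y⟩ : ℂ) = w + ((z'.re - z.re : ℝ) : ℂ) := by
    apply Complex.ext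
    · simp; ring
    · simp
  rw [e] at hs
  have hm := add_mem_interior_of_mem_leftEdges hw (sub_pos.2 hlt) (by linarith)
  exact notMem_interior_of_mem_leftEdges hw' (hs.eq_of_mem_interior ho' hm ▸ hm)

/-- The same argument with a vertical segment, the height 1/2 replacing the width 1. -/
lemma IsTranslationOn.half_le_of_bottomEdges (hι : IsTranslationOn ι D) (hD : Convex ℝ D)
    (hz : z ∈ D) (hz' : z' ∈ D) (hlt : z.im < z'.im) (h : ∃ w ∈ bottomEdges, LiesOver w (ι z))
    (h' : ∃ w ∈ bottomEdges, LiesOver w (ι z'))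
    {x : ℝ} (hx : (⟨x, z.im⟩ : ℂ) ∈ D) (hx' : (⟨x, z'.im⟩ : ℂ) ∈ D) : z.im + 1 / 2 ≤ z'.im := by
  by_contra hn
  push Not at hn
  obtain ⟨w, hw, ho⟩ := hι.bottomEdges_of_im_eq hD hz hx rfl h
  obtain ⟨w', hw', ho'⟩ := hι.bottomEdges_of_im_eq hD hz' hx' rfl h'
  have hs := hι.liesOver_segment hD hx hx' ho (by
    intro a ha
    obtain ⟨t, ⟨ht₀, ht₁⟩, rfl⟩ := (segment_eq_image_lineMap ℝ _ _).subset ha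
    have e : w - ⟨x, z.im⟩ + AffineMap.lineMap (⟨x, z.im⟩ : ℂ) ⟨x, z'.im⟩ t =
        w + ((t * (z'.im - z.im) : ℝ) : ℂ) * Complex.I := by
      apply Complex.ext <;> simp [AffineMap.lineMap_apply]
    rw [e]
    rcases ht₀.eq_or_lt with rfl | ht₀
    · simpa using ho.mem
    · exact polygonInterior_subset
        (add_mem_interior_of_mem_bottomEdges hw (by nlinarith) (by nlinarith)))
  have e : w - ⟨x, z.im⟩ + (⟨x, z'.im⟩ : ℂ) = w + ((z'.im - z.im : ℝ) : ℂ) * Complex.I := by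
    apply Complex.ext <;> simp
    ring
  rw [e] at hs
  have hm := add_mem_interior_of_mem_bottomEdges hw (sub_pos.2 hlt) (by linarith)
  exact notMem_interior_of_mem_bottomEdges hw' (hs.eq_of_mem_interior ho' hm ▸ hm)

/-! ### Rays in the polygon -/

/-- The closed polygon, with the endpoints of the edges. -/
def closedPolygon : Set ℂ :=
  {z | (0 ≤ z.re ∧ z.re ≤ 1 ∧ 1 / 2 ≤ z.im ∧ z.im ≤ 1) ∨
    (-1 / 2 ≤ z.re ∧ z.re ≤ 1 / 2 ∧ 0 ≤ z.im ∧ z.im ≤ 1 / 2)}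

lemma isClosed_closedPolygon : IsClosed closedPolygon := by
  have h : ∀ a b c d : ℝ, IsClosed {z : ℂ | a ≤ z.re ∧ z.re ≤ b ∧ c ≤ z.im ∧ z.im ≤ d} := by
    intro a b c d
    have hre := Complex.continuous_re
    have him := Complex.continuous_im
    exact (isClosed_le continuous_const hre).inter ((isClosed_le hre continuous_const).inter
      ((isClosed_le continuous_const him).inter (isClosed_le him continuous_const)))
  exact (h _ _ _ _).union (h _ _ _ _)

lemma eventually_small {d : ℝ} (hd : 0 < d) : ∀ᶠ s : ℝ in 𝓝[>] 0, 0 < s ∧ s < d :=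
  Ioo_mem_nhdsGT hd

lemma eventually_add_mul_ne (x c : ℝ) {k : ℝ} (hk : k ≠ 0) :
    ∀ᶠ s : ℝ in 𝓝[>] 0, x + s * k ≠ c := by
  rcases eq_or_ne ((c - x) / k) 0 with h | h
  · filter_upwards [self_mem_nhdsWithin] with s hs he
    have : s = (c - x) / k := by field_simp; linarith
    exact (ne_of_gt hs) (this.trans h)
  · filter_upwards [nhdsWithin_le_nhds (isOpen_ne.mem_nhds h.symm)] with s hs he
    exact hs (by field_simp; linarith)

lemma mem_interior_of_mem_closedPolygon {z : ℂ} (h : z ∈ closedPolygon) (h₁ : z.re ≠ -1 / 2)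
    (h₂ : z.re ≠ 0) (h₃ : z.re ≠ 1 / 2) (h₄ : z.re ≠ 1) (h₅ : z.im ≠ 0) (h₆ : z.im ≠ 1 / 2)
    (h₇ : z.im ≠ 1) : z ∈ polygonInterior := by
  rcases h with ⟨a, b, c, d⟩ | ⟨a, b, c, d⟩
  · exact mem_upper (lt_of_le_of_ne a h₂.symm) (lt_of_le_of_ne b h₄)
      (lt_of_le_of_ne c h₆.symm) (lt_of_le_of_ne d h₇)
  · exact mem_lower (lt_of_le_of_ne a h₁.symm) (lt_of_le_of_ne b h₃)
      (lt_of_le_of_ne c h₅.symm) (lt_of_le_of_ne d h₆)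

lemma mem_polygon_of_im_eq_half {z : ℂ} (h : z ∈ closedPolygon) (h₁ : z.re ≠ -1 / 2)
    (h₂ : z.re ≠ 0) (h₃ : z.re ≠ 1 / 2) (h₄ : z.re ≠ 1) (h₅ : z.im = 1 / 2) : z ∈ polygon := by
  have hb : -1 / 2 ≤ z.re ∧ z.re ≤ 1 := by
    rcases h with ⟨a, b, -, -⟩ | ⟨a, b, -, -⟩ <;> constructor <;> linarith
  have hl := lt_of_le_of_ne hb.1 h₁.symm
  have hr := lt_of_le_of_ne hb.2 h₄
  rcases lt_or_gt_of_ne h₂ with h | h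
  · have hg := (Glue.D z.re hl h).left_mem
    rwa [show (⟨z.re, 1 / 2⟩ : ℂ) = z from Complex.ext rfl h₅.symm] at hg
  · rcases lt_or_gt_of_ne h₃ with h' | h'
    · exact polygonInterior_subset (Or.inr (Or.inr ⟨h, h', by linarith, by linarith⟩))
    · have hg := (Glue.D (z.re - 1) (by linarith) (by linarith)).right_mem
      rwa [show (⟨z.re - 1 + 1, 1 / 2⟩ : ℂ) = z from Complex.ext (by simp) h₅.symm] at hg

/-- To the right of a point of the top side, there is an edge. -/
lemma eventually_top_mem {x : ℝ} (h₀ : 0 ≤ x) (h₁ : x < 1) :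
    ∀ᶠ s : ℝ in 𝓝[>] 0, (⟨x + s, 1⟩ : ℂ) ∈ polygon := by
  -- `(1/2)^(n+1) < 1 - x ≤ (1/2)^n` places `x` in the block formed by `C' (n+1)` and `C'' (n+1)`,
  -- left endpoint included. The threshold `3 * (1/2)^(n+2)` is the distance from the common
  -- endpoint of these two edges to the corner.
  obtain ⟨n, hn, hn'⟩ := exists_nat_pow_near_of_lt_one (sub_pos.2 h₁) (by linarith)
    (by norm_num : (0 : ℝ) < 1 / 2) (by norm_num)
  have e := pow_succ (1 / 2 : ℝ) n
  have e' := pow_succ (1 / 2 : ℝ) (n + 1)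
  rcases lt_or_ge (3 * (1 / 2) ^ (n + 1 + 1)) (1 - x) with h | h
  · filter_upwards [eventually_small (sub_pos.2 h)] with s hs
    exact (Glue.C' (n + 1) (x + s) (by omega) (by linarith) (by linarith)).left_mem
  · filter_upwards [eventually_small (sub_pos.2 hn)] with s hs
    exact (Glue.C'' (n + 1) (x + s) (by omega) (by linarith) (by linarith)).left_mem

/-- To the right of a point of the bottom side, there is an edge. -/
lemma eventually_bottom_mem {x : ℝ} (h₀ : -1 / 2 ≤ x) (h₁ : x < 1 / 2) :
    ∀ᶠ s : ℝ in 𝓝[>] 0, (⟨x + s, 0⟩ : ℂ) ∈ polygon := by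
  obtain ⟨n, hn, hn'⟩ := exists_nat_pow_near_of_lt_one (sub_pos.2 h₁) (by linarith)
    (by norm_num : (0 : ℝ) < 1 / 2) (by norm_num)
  have e := pow_succ (1 / 2 : ℝ) n
  have e' := pow_succ (1 / 2 : ℝ) (n + 1)
  rcases lt_or_ge (3 * (1 / 2) ^ (n + 1 + 1)) (1 / 2 - x) with h | h
  · filter_upwards [eventually_small (sub_pos.2 h)] with s hs
    have hg := (Glue.C'' (n + 1) (x + s + (1 / 2) ^ (n + 1 + 1) + 1 / 2) (by omega) (by linarith)
      (by linarith)).right_mem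
    convert hg using 2
    ring
  · filter_upwards [eventually_small (sub_pos.2 hn)] with s hs
    have hg := (Glue.C' (n + 1) (x + s - (1 / 2) ^ (n + 1 + 1) + 1 / 2) (by omega) (by linarith)
      (by linarith)).right_mem
    convert hg using 2
    ring

/-- A ray to the right that starts inside the closed polygon does so off the endpoints of the
edges. -/
lemma eventually_ray_mem {c : ℂ} {m : ℝ}
    (h : ∀ᶠ s : ℝ in 𝓝[>] 0, c + ⟨s, s * m⟩ ∈ closedPolygon) :
    ∀ᶠ s : ℝ in 𝓝[>] 0, c + ⟨s, s * m⟩ ∈ polygon := by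
  have hre : ∀ x : ℝ, ∀ᶠ s : ℝ in 𝓝[>] 0, (c + ⟨s, s * m⟩ : ℂ).re ≠ x := fun x => by
    simpa using eventually_add_mul_ne c.re x one_ne_zero
  have hall := h.and ((hre (-1 / 2)).and ((hre 0).and ((hre (1 / 2)).and (hre 1))))
  rcases eq_or_ne m 0 with rfl | hm
  -- A horizontal ray either runs along one of the heights 0, 1/2, 1 or avoids all three.
  · have him : ∀ s : ℝ, (c + ⟨s, s * 0⟩ : ℂ).im = c.im := fun s => by simp
    have hext : ∀ s : ℝ, (c + ⟨s, s * 0⟩ : ℂ) = ⟨c.re + s, c.im⟩ := fun s => by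
      apply Complex.ext <;> simp
    have hmem : c ∈ closedPolygon := by
      refine isClosed_closedPolygon.mem_of_tendsto (b := 𝓝[>] (0 : ℝ)) ?_ h
      have : ContinuousAt (fun s : ℝ => c + (s : ℂ)) 0 := by fun_prop
      have ht := this.tendsto.mono_left (nhdsWithin_le_nhds (s := Ioi 0))
      refine (by simpa using ht : Tendsto (fun s : ℝ => c + (s : ℂ)) (𝓝[>] 0) (𝓝 c)).congr ?_
      intro s
      apply Complex.ext <;> simp
    rcases eq_or_ne c.im (1 / 2) with h₁ | h₁
    · filter_upwards [hall] with s hs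
      exact mem_polygon_of_im_eq_half hs.1 hs.2.1 hs.2.2.1 hs.2.2.2.1 hs.2.2.2.2 ((him s).trans h₁)
    obtain ⟨s, ⟨hs, -⟩, hs₀⟩ := (hall.and self_mem_nhdsWithin).exists
    rw [hext] at hs
    replace hs₀ : 0 < s := hs₀
    rcases eq_or_ne c.im 0 with h₀ | h₀
    · simp only [hext, h₀]
      rcases hmem with hmem | hmem
      · linarith [hmem.2.2.1]
      rcases hs with hs | hs
      · linarith [hs.2.2.1]
      exact eventually_bottom_mem hmem.1 (by linarith [hs.2.1])
    rcases eq_or_ne c.im 1 with h₂ | h₂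
    · simp only [hext, h₂]
      rcases hmem with hmem | hmem
      · rcases hs with hs | hs
        · exact eventually_top_mem hmem.1 (by linarith [hs.2.1])
        · linarith [hs.2.2.2]
      · linarith [hmem.2.2.2]
    filter_upwards [hall] with s hs
    refine polygonInterior_subset (mem_interior_of_mem_closedPolygon hs.1 hs.2.1 hs.2.2.1
      hs.2.2.2.1 hs.2.2.2.2 ?_ ?_ ?_) <;> rwa [him]
  -- A slanted ray leaves every horizontal and every vertical line at once, so it enters the
  -- interior.
  · have him : ∀ y : ℝ, ∀ᶠ s : ℝ in 𝓝[>] 0, (c + ⟨s, s * m⟩ : ℂ).im ≠ y := fun y => by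
      simpa using eventually_add_mul_ne c.im y hm
    filter_upwards [hall, him 0, him (1 / 2), him 1] with s hs h₁ h₂ h₃
    exact polygonInterior_subset (mem_interior_of_mem_closedPolygon hs.1 hs.2.1 hs.2.2.1
      hs.2.2.2.1 hs.2.2.2.2 h₁ h₂ h₃)

/-! ### Half discs in the surface -/

/-- The part of a small square around `0` that lies in an open half-plane. -/
def halfSquare (a b r : ℝ) : Set ℂ :=
  {z | 0 < a * z.re + b * z.im ∧ |z.re| < r ∧ |z.im| < r}

lemma halfSquare_mono {a b r r' : ℝ} (h : r' ≤ r) : halfSquare a b r' ⊆ halfSquare a b r :=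
  fun _ hz => ⟨hz.1, hz.2.1.trans_le h, hz.2.2.trans_le h⟩

lemma convex_pos (a b : ℝ) : Convex ℝ {z : ℂ | 0 < a * z.re + b * z.im} :=
  convex_halfSpace_gt (a • Complex.reLm + b • Complex.imLm).isLinear 0

lemma convex_halfSquare (a b r : ℝ) : Convex ℝ (halfSquare a b r) := by
  have h : halfSquare a b r = {z : ℂ | 0 < a * z.re + b * z.im} ∩
      (Complex.reLm ⁻¹' Metric.ball 0 r ∩ Complex.imLm ⁻¹' Metric.ball 0 r) := by
    ext z
    simp [halfSquare]
  rw [h]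
  exact (convex_pos a b).inter (((convex_ball 0 r).linear_preimage _).inter
    ((convex_ball 0 r).linear_preimage _))

variable {ι : ℂ → Surface} {a b r : ℝ}

/-- The square has width at most 1/2, which is less than the distance 1 between two lines of left
edges. -/
lemma re_eq_of_leftEdges (hr : r ≤ 1 / 4) (hι : IsTranslationOn ι (halfSquare a b r)) {z z' : ℂ}
    (hz : z ∈ halfSquare a b r) (hz' : z' ∈ halfSquare a b r)
    (h : ∃ w ∈ leftEdges, LiesOver w (ι z)) (h' : ∃ w ∈ leftEdges, LiesOver w (ι z')) :
    z.re = z'.re := by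
  -- Of the two heights, the one with the larger product with `b` keeps both points in the
  -- half-plane.
  have hy : ∃ y : ℝ, (⟨z.re, y⟩ : ℂ) ∈ halfSquare a b r ∧ (⟨z'.re, y⟩ : ℂ) ∈ halfSquare a b r := by
    rcases le_total z.im z'.im with hle | hle <;> rcases le_total 0 b with hb | hb
    · exact ⟨z'.im, ⟨by nlinarith [hz.1], hz.2.1, hz'.2.2⟩, hz'⟩
    · exact ⟨z.im, hz, ⟨by nlinarith [hz'.1], hz'.2.1, hz.2.2⟩⟩
    · exact ⟨z.im, hz, ⟨by nlinarith [hz'.1], hz'.2.1, hz.2.2⟩⟩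
    · exact ⟨z'.im, ⟨by nlinarith [hz.1], hz.2.1, hz'.2.2⟩, hz'⟩
  obtain ⟨y, hy, hy'⟩ := hy
  have h₁ := abs_lt.1 hz.2.1
  have h₂ := abs_lt.1 hz'.2.1
  rcases lt_trichotomy z.re z'.re with hlt | heq | hlt
  · linarith [hι.one_le_of_leftEdges (convex_halfSquare a b r) hz hz' hlt h h' hy hy', h₁.1, h₂.2]
  · exact heq
  · linarith [hι.one_le_of_leftEdges (convex_halfSquare a b r) hz' hz hlt h' h hy' hy, h₂.1, h₁.2]

lemma im_eq_of_bottomEdges (hr : r ≤ 1 / 4) (hι : IsTranslationOn ι (halfSquare a b r))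
    {z z' : ℂ} (hz : z ∈ halfSquare a b r) (hz' : z' ∈ halfSquare a b r)
    (h : ∃ w ∈ bottomEdges, LiesOver w (ι z)) (h' : ∃ w ∈ bottomEdges, LiesOver w (ι z')) :
    z.im = z'.im := by
  have hx : ∃ x : ℝ, (⟨x, z.im⟩ : ℂ) ∈ halfSquare a b r ∧ (⟨x, z'.im⟩ : ℂ) ∈ halfSquare a b r := by
    rcases le_total z.re z'.re with hle | hle <;> rcases le_total 0 a with ha | ha
    · exact ⟨z'.re, ⟨by nlinarith [hz.1], hz'.2.1, hz.2.2⟩, hz'⟩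
    · exact ⟨z.re, hz, ⟨by nlinarith [hz'.1], hz.2.1, hz'.2.2⟩⟩
    · exact ⟨z.re, hz, ⟨by nlinarith [hz'.1], hz.2.1, hz'.2.2⟩⟩
    · exact ⟨z'.re, ⟨by nlinarith [hz.1], hz'.2.1, hz.2.2⟩, hz'⟩
  obtain ⟨x, hx, hx'⟩ := hx
  have h₁ := abs_lt.1 hz.2.2
  have h₂ := abs_lt.1 hz'.2.2
  rcases lt_trichotomy z.im z'.im with hlt | heq | hlt
  · linarith [hι.half_le_of_bottomEdges (convex_halfSquare a b r) hz hz' hlt h h' hx hx', h₁.1,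
      h₂.2]
  · exact heq
  · linarith [hι.half_le_of_bottomEdges (convex_halfSquare a b r) hz' hz hlt h' h hx' hx, h₂.1,
      h₁.2]

/-- Near the origin, a half disc in the surface meets the edges at most on the axes. -/
lemma exists_edges_subset_axes (hr₀ : 0 < r) (hr : r ≤ 1 / 4)
    (hι : IsTranslationOn ι (halfSquare a b r)) : ∃ r' > 0, r' ≤ r ∧ ∀ z ∈ halfSquare a b r',
      ((∃ w ∈ leftEdges, LiesOver w (ι z)) → z.re = 0) ∧
      ((∃ w ∈ bottomEdges, LiesOver w (ι z)) → z.im = 0) := by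
  have h₁ : ∃ r' > 0, r' ≤ r ∧ ∀ z ∈ halfSquare a b r',
      (∃ w ∈ leftEdges, LiesOver w (ι z)) → z.re = 0 := by
    by_cases h : ∃ z ∈ halfSquare a b r, (∃ w ∈ leftEdges, LiesOver w (ι z)) ∧ z.re ≠ 0
    -- All left edges have the abscissa of this one, so the smaller square of size `|z.re|` misses
    -- them.
    · obtain ⟨z, hz, hw, h₀⟩ := h
      refine ⟨|z.re|, abs_pos.2 h₀, hz.2.1.le, fun z' hz' hw' => ?_⟩
      have := re_eq_of_leftEdges hr hι hz (halfSquare_mono hz.2.1.le hz') hw hw'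
      exact absurd hz'.2.1 (by rw [this]; exact lt_irrefl _)
    · push Not at h
      exact ⟨r, hr₀, le_rfl, h⟩
  have h₂ : ∃ r' > 0, r' ≤ r ∧ ∀ z ∈ halfSquare a b r',
      (∃ w ∈ bottomEdges, LiesOver w (ι z)) → z.im = 0 := by
    by_cases h : ∃ z ∈ halfSquare a b r, (∃ w ∈ bottomEdges, LiesOver w (ι z)) ∧ z.im ≠ 0
    · obtain ⟨z, hz, hw, h₀⟩ := h
      refine ⟨|z.im|, abs_pos.2 h₀, hz.2.2.le, fun z' hz' hw' => ?_⟩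
      have := im_eq_of_bottomEdges hr hι hz (halfSquare_mono hz.2.2.le hz') hw hw'
      exact absurd hz'.2.2 (by rw [this]; exact lt_irrefl _)
    · push Not at h
      exact ⟨r, hr₀, le_rfl, h⟩
  obtain ⟨r₁, p₁, l₁, h₁⟩ := h₁
  obtain ⟨r₂, p₂, l₂, h₂⟩ := h₂
  exact ⟨min r₁ r₂, lt_min p₁ p₂, (min_le_left _ _).trans l₁, fun z hz =>
    ⟨h₁ z (halfSquare_mono (min_le_left _ _) hz), h₂ z (halfSquare_mono (min_le_right _ _) hz)⟩⟩

lemma neBot_nhdsWithin_pos (hb : b ≠ 0) {z : ℂ} (hz : a * z.re + b * z.im = 0) :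
    (𝓝[{z : ℂ | 0 < a * z.re + b * z.im}] z).NeBot := by
  rw [← mem_closure_iff_nhdsWithin_neBot]
  have hc : ContinuousAt (fun s : ℝ => z + (s : ℂ) * (b * Complex.I)) 0 := by fun_prop
  have ht := hc.tendsto.mono_left (nhdsWithin_le_nhds (s := Ioi 0))
  simp only [Complex.ofReal_zero, zero_mul, add_zero] at ht
  refine mem_closure_of_tendsto ht ?_
  filter_upwards [self_mem_nhdsWithin] with s hs
  have h₁ : 0 < s * b ^ 2 := mul_pos hs (by positivity)
  simp
  nlinarith

/-- Along the boundary line of a half disc in the surface, which is not vertical, the points to the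
right of the centre and close to it are not singular. -/
lemma eventually_exists_tendsto {m : ℝ} (hr : 0 < r) (hb : b ≠ 0) (hab : a + b * m = 0)
    (hι : IsTranslationOn ι (halfSquare a b r)) :
    ∀ᶠ s : ℝ in 𝓝[>] 0, ∃ x,
      Tendsto ι (𝓝[{z : ℂ | 0 < a * z.re + b * z.im}] ⟨s, s * m⟩) (𝓝 x) := by
  obtain ⟨r', hr', hle, hax⟩ := exists_edges_subset_axes (lt_min hr (by norm_num))
    (min_le_right r (1 / 4)) (hι.mono (halfSquare_mono (min_le_left r (1 / 4))))
  -- The sign of `σ` tells on which side of the horizontal axis the sector lies. A slanted ray has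
  -- the sign of `m` itself; along a horizontal one the half-plane is `0 < b * z.im`.
  set σ : ℝ := if m = 0 then b else m with hσ
  -- the sector next to the right half of the boundary line
  set K : Set ℂ := halfSquare a b r' ∩ ({z : ℂ | 0 < z.re} ∩ {z : ℂ | 0 < σ * z.im})
  have hKc : Convex ℝ K := by
    refine (convex_halfSquare a b r').inter (Convex.inter ?_ ?_)
    · simpa using convex_pos 1 0
    · simpa using convex_pos 0 σ
  have hKι : IsTranslationOn ι K :=
    hι.mono fun z hz => halfSquare_mono (hle.trans (min_le_left _ _)) hz.1
  have hnear : ∀ᶠ s : ℝ in 𝓝[>] 0, ∀ᶠ z in 𝓝[{z : ℂ | 0 < a * z.re + b * z.im}] ⟨s, s * m⟩,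
      z ∈ K := by
    -- For `s` below this bound, both coordinates of `⟨s, s * m⟩` are smaller than `r'` in absolute
    -- value.
    have hd : 0 < r' / (1 + |m|) := by positivity
    filter_upwards [eventually_small hd] with s hs
    have hsr : s * (1 + |m|) < r' := (lt_div_iff₀ (by positivity)).1 hs.2
    have hsm : 0 ≤ s * |m| := mul_nonneg hs.1.le (abs_nonneg m)
    have h₁ : |s| < r' := by rw [abs_of_pos hs.1]; linarith
    have h₂ : |s * m| < r' := by rw [abs_mul, abs_of_pos hs.1]; linarith [hs.1]
    have hre := Complex.continuous_re
    have him := Complex.continuous_im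
    have o₁ := (isOpen_lt hre.abs continuous_const).mem_nhds
      (show (⟨s, s * m⟩ : ℂ) ∈ {z : ℂ | |z.re| < r'} from h₁)
    have o₂ := (isOpen_lt him.abs continuous_const).mem_nhds
      (show (⟨s, s * m⟩ : ℂ) ∈ {z : ℂ | |z.im| < r'} from h₂)
    have o₃ := (isOpen_lt continuous_const hre).mem_nhds
      (show (⟨s, s * m⟩ : ℂ) ∈ {z : ℂ | 0 < z.re} from hs.1)
    have o₄ : ∀ᶠ z in 𝓝[{z : ℂ | 0 < a * z.re + b * z.im}] ⟨s, s * m⟩, 0 < σ * z.im := by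
      by_cases hm : m = 0
      · filter_upwards [self_mem_nhdsWithin] with z hz
        have ha : a = 0 := by simpa [hm] using hab
        simpa [hσ, hm, ha] using hz
      · apply nhdsWithin_le_nhds
        refine (isOpen_lt continuous_const (continuous_const.mul him)).mem_nhds ?_
        have : 0 < m * (s * m) := by
          have := mul_pos hs.1 (by positivity : 0 < m ^ 2)
          nlinarith
        simpa [hσ, hm] using this
    filter_upwards [self_mem_nhdsWithin, nhdsWithin_le_nhds o₁, nhdsWithin_le_nhds o₂,
      nhdsWithin_le_nhds o₃, o₄] with z hz h₁ h₂ h₃ h₄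
    exact ⟨⟨hz, h₁, h₂⟩, h₃, h₄⟩
  have hne : ∀ s : ℝ, (𝓝[{z : ℂ | 0 < a * z.re + b * z.im}] (⟨s, s * m⟩ : ℂ)).NeBot := fun s =>
    neBot_nhdsWithin_pos hb (by simp only; linear_combination s * hab)
  -- The sector avoids both axes, and `hax` confines the edges to them.
  have hint : ∀ z ∈ K, ∀ w, LiesOver w (ι z) → w ∈ polygonInterior := by
    intro z hz w hw
    rcases hw.cases with h | h | h
    · exact h
    · exact absurd ((hax z hz.1).1 h) (ne_of_gt hz.2.1)
    · have h₀ := (hax z hz.1).2 h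
      have := hz.2.2
      simp [h₀] at this
  obtain ⟨s₀, hs₀⟩ := hnear.exists
  obtain ⟨z₀, hz₀⟩ := hs₀.exists
  obtain ⟨p, hp⟩ := exists_liesOver (ι z₀)
  have hlift := hKι.lift hKc.isPreconnected (E := polygon) (c := p - z₀) (fun a _ h => h) hz₀
    (by simpa using hp.mem) (by simpa using hp) (by
      intro z hz _ ho
      have hc : ContinuousAt (fun w : ℂ => p - z₀ + w) z := by fun_prop
      filter_upwards [nhdsWithin_le_nhds (hc.eventually_mem
        (isOpen_polygonInterior.mem_nhds (hint z hz _ ho)))] with w hw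
      exact ⟨polygonInterior_subset hw, polygonInterior_subset hw⟩)
  have hadd : ∀ z : ℂ, Tendsto (fun w : ℂ => p - z₀ + w) (𝓝 z) (𝓝 (p - z₀ + z)) := fun z =>
    Continuous.tendsto (by fun_prop) z
  have hray := eventually_ray_mem (c := p - z₀) (m := m) (by
    filter_upwards [hnear] with s hs
    have := hne s
    refine isClosed_closedPolygon.mem_of_tendsto ((hadd _).mono_left nhdsWithin_le_nhds)
      (hs.mono fun z hz => mem_closed_of_mem (hlift z hz).1))
  filter_upwards [hray, hnear] with s hm hs
  -- On the sector, `ι` is the translation by `p - z₀` followed by the projection, so continuity of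
  -- `proj` at the translated boundary point gives the limit.
  refine ⟨proj ⟨_, hm⟩, ?_⟩
  intro U hU
  rw [mem_map]
  have h₁ := continuous_proj.continuousAt.preimage_mem_nhds hU
  rw [nhds_subtype_eq_comap, mem_comap] at h₁
  obtain ⟨V, hV, hVU⟩ := h₁
  filter_upwards [hs, nhdsWithin_le_nhds (hadd _ hV)] with z hz hzV
  obtain ⟨q, hq, hqz⟩ := (hlift z hz).2
  rw [mem_preimage, ← hqz]
  exact hVU (by rw [mem_preimage, hq]; exact hzV)

/-! ### The half disc at the point `(0, 2/3)` -/

/-- This is the upper endpoint of the copy of `B n` on `{0} × [2/3, 1]`. Edges there have odd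
indices, so the lengths of different ones differ by a factor of at least 4 and none of them covers
the point. -/
lemma notMem_polygon_above {n : ℕ} (hn : ¬ Even n) :
    (⟨0, 2 / 3 + 2 / 3 * (1 / 2) ^ n⟩ : ℂ) ∉ polygon := by
  have h₀ := half_pow_pos n
  rintro (h | ⟨w, h | h⟩)
  · rcases h with h | h | h <;> linarith [h.1, h.2.1, h.2.2.1, h.2.2.2]
  · rcases h.left with h | h | h | h <;> linarith [h.1, h.2.1, h.2.2]
  · obtain ⟨m, ⟨he, h₁, h₂, -⟩ | ⟨he, h₁, h₂, -⟩⟩ :=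
      h.of_right_zero rfl (by simp only; linarith)
    · simp only at h₁ h₂
      linarith [half_pow_pos m]
    · simp only at h₁ h₂
      rcases half_pow_cases' n m (by tauto) with rfl | h | h <;> linarith

/-- This is the lower endpoint of the copy of `A n` on `{0} × [1/2, 2/3]`. The bound on `n` excludes
`n = 2`, for which it is `(0, 1/2)` and `Glue.of_right_zero` does not apply. -/
lemma notMem_polygon_below {n : ℕ} (hn : Even n) (hn' : 3 ≤ n) :
    (⟨0, 2 / 3 - 2 / 3 * (1 / 2) ^ n⟩ : ℂ) ∉ polygon := by
  have h₀ := half_pow_pos n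
  have hs : ((1 / 2) ^ n : ℝ) ≤ 1 / 8 := by
    refine (pow_le_pow_of_le_one (by norm_num) (by norm_num) hn').trans ?_
    norm_num
  rintro (h | ⟨w, h | h⟩)
  · rcases h with h | h | h <;> linarith [h.1, h.2.1, h.2.2.1, h.2.2.2]
  · rcases h.left with h | h | h | h <;> linarith [h.1, h.2.1, h.2.2]
  · obtain ⟨m, ⟨he, h₁, h₂, -⟩ | ⟨he, h₁, h₂, -⟩⟩ :=
      h.of_right_zero rfl (by simp only; linarith)
    · simp only at h₁ h₂
      rcases half_pow_cases' n m (by tauto) with rfl | h | h <;> linarith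
    · simp only at h₁ h₂
      linarith [half_pow_pos m]

/-- Endpoints of edges accumulate at `(0, 2/3)` from above and from below. -/
lemma frequently_notMem_polygon {c : ℝ} (hc : c ≠ 0) :
    ∃ᶠ s : ℝ in 𝓝[>] 0, (⟨0, 2 / 3 + s * c⟩ : ℂ) ∉ polygon := by
  have key : ∀ (d : ℝ) (g : ℕ → ℕ), 0 < d → Tendsto g atTop atTop →
      Tendsto (fun k => d * (1 / 2 : ℝ) ^ g k) atTop (𝓝[>] 0) := by
    intro d g hd hg
    refine tendsto_nhdsWithin_iff.2 ⟨?_, Eventually.of_forall fun k => ?_⟩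
    · simpa using ((tendsto_pow_atTop_nhds_zero_of_lt_one (by norm_num : (0 : ℝ) ≤ 1 / 2)
        (by norm_num)).comp hg).const_mul d
    · have := half_pow_pos (g k)
      exact mul_pos hd this
  rcases lt_or_gt_of_ne hc with h | h
  -- The factor is chosen so that `s * c` equals `-(2/3) * (1/2)^(2k+4)`, the offset of a lower
  -- endpoint.
  · refine (key (2 / 3 / -c) (fun k => 2 * k + 4) (div_pos (by norm_num) (by linarith))
      (tendsto_atTop_mono (fun k : ℕ => by simp only [id]; lia) tendsto_id)).frequently
        (Frequently.of_forall fun k => ?_)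
    convert notMem_polygon_below (n := 2 * k + 4) ⟨k + 2, by ring⟩ (by omega) using 3
    field_simp
    ring
  · refine (key (2 / 3 / c) (fun k => 2 * k + 1) (div_pos (by norm_num) h)
      (tendsto_atTop_mono (fun k : ℕ => by simp only [id]; lia) tendsto_id)).frequently
        (Frequently.of_forall fun k => ?_)
    convert notMem_polygon_above (n := 2 * k + 1) (by simp) using 3
    field_simp

/-- Translations into the surface are total functions on `ℂ`, so the projection needs values off the
polygon. These are irrelevant; the point `(1/4, 1/4)` only supplies one. -/
lemma exists_extension_proj : ∃ f : ℂ → Surface, ∀ a ∈ polygon, LiesOver a (f a) := by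
  have h : (⟨1 / 4, 1 / 4⟩ : ℂ) ∈ polygon := by
    apply polygonInterior_subset
    apply mem_lower <;> norm_num
  refine ⟨Function.extend Subtype.val proj fun _ => proj ⟨_, h⟩, fun a ha => ⟨⟨a, ha⟩, rfl, ?_⟩⟩
  exact (Subtype.val_injective.extend_apply proj _ ⟨a, ha⟩).symm

lemma isTranslationOn_extension {f : ℂ → Surface} (hf : ∀ a ∈ polygon, LiesOver a (f a)) (c : ℂ) :
    IsTranslationOn (fun z => f (c + z)) {z | c + z ∈ polygonInterior} := by
  intro z hz
  have hadd : Tendsto (fun w : ℂ => c + w) (𝓝 z) (𝓝 (c + z)) := Continuous.tendsto (by fun_prop) z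
  have hn := isOpen_polygonInterior.mem_nhds hz
  have hcont : ContinuousOn f polygon := by
    rw [continuousOn_iff_continuous_domRestrict]
    convert continuous_proj using 1
    funext a
    obtain ⟨p, hp, hp'⟩ := hf a a.2
    rw [show a = p from Subtype.ext hp.symm] at *
    exact hp'.symm
  refine ⟨ContinuousAt.comp (f := fun w : ℂ => c + w) (hcont.continuousAt
    (mem_of_superset hn polygonInterior_subset)) hadd, fun e he hx => ?_⟩
  filter_upwards [hadd.eventually (he.eventually_of_liesOver hx (hf _ (polygonInterior_subset hz))),
    hadd hn] with w hw hw'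
  rw [(hw _ (hf _ (polygonInterior_subset hw'))).2]
  ring

/-! ### Derivatives of affine maps -/

/-- One pair of charts suffices, since canonical charts differ locally by translations, which cancel
in the differences. -/
lemma hasAffineDerivAt_of_charts {φ : Surface → Surface} (hφ : Continuous φ) {A : ℂ ≃ₗ[ℝ] ℂ}
    {x : Surface} {e e' : OpenPartialHomeomorph Surface ℂ} (he : IsCanonicalChart e)
    (he' : IsCanonicalChart e') (hx : x ∈ e.source) (hx' : φ x ∈ e'.source)
    (h : ∀ᶠ y in 𝓝 x, e' (φ y) = e' (φ x) + A (e y - e x)) : HasAffineDerivAt φ A x := by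
  intro e₁ he₁ e₁' he₁' hx₁ hx₁'
  filter_upwards [h, he.eventually_eq he₁ hx hx₁,
    hφ.continuousAt.eventually (he'.eventually_eq he₁' hx' hx₁')] with y h₁ h₂ h₃
  rw [h₃, h₂, h₁]
  simp

lemma HasAffineDerivAt.eventually {φ : Surface → Surface} (hφ : Continuous φ) {A : ℂ ≃ₗ[ℝ] ℂ}
    {x : Surface} (h : HasAffineDerivAt φ A x) : ∀ᶠ y in 𝓝 x, HasAffineDerivAt φ A y := by
  obtain ⟨e, he, hx⟩ := exists_canonicalChart x
  obtain ⟨e', he', hx'⟩ := exists_canonicalChart (φ x)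
  filter_upwards [eventually_eventually_nhds.2 (h e he e' he' hx hx'), e.open_source.mem_nhds hx,
    hφ.continuousAt.preimage_mem_nhds (e'.open_source.mem_nhds hx')] with y hy hys hys'
  refine hasAffineDerivAt_of_charts hφ he he' hys hys' ?_
  filter_upwards [hy] with z hz
  rw [hz, hy.self_of_nhds, add_assoc, ← map_add]
  congr 2
  ring

lemma HasAffineDerivAt.unique {φ : Surface → Surface} {A B : ℂ ≃ₗ[ℝ] ℂ} {x : Surface}
    (hA : HasAffineDerivAt φ A x) (hB : HasAffineDerivAt φ B x) : A = B := by
  obtain ⟨e, he, hx⟩ := exists_canonicalChart x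
  obtain ⟨e', he', hx'⟩ := exists_canonicalChart (φ x)
  have h : ∀ᶠ y in 𝓝 x, A (e y - e x) = B (e y - e x) := by
    filter_upwards [hA e he e' he' hx hx', hB e he e' he' hx hx'] with y h₁ h₂
    exact add_left_cancel (h₁.symm.trans h₂)
  ext v
  -- Test both linear maps on a small nonzero multiple of `v`, which is realized by a point near
  -- `x`.
  have hs : Tendsto (fun t : ℝ => e.symm (e x + t • v)) (𝓝[≠] 0) (𝓝 x) := by
    have h₁ := e.continuousAt_symm (e.map_source hx)
    have h₂ : Tendsto (fun t : ℝ => e x + t • v) (𝓝[≠] 0) (𝓝 (e x)) := by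
      have : ContinuousAt (fun t : ℝ => e x + t • v) 0 := by fun_prop
      simpa [ContinuousAt] using this.tendsto.mono_left (nhdsWithin_le_nhds (s := {0}ᶜ))
    have h₃ := h₁.tendsto.comp h₂
    rwa [e.left_inv hx] at h₃
  have ht : ∀ᶠ t : ℝ in 𝓝[≠] 0, e x + t • v ∈ e.target := by
    have : ContinuousAt (fun t : ℝ => e x + t • v) 0 := by fun_prop
    exact nhdsWithin_le_nhds (this.eventually_mem
      (e.open_target.mem_nhds (by simpa using e.map_source hx)))
  obtain ⟨t, ⟨h₁, h₂⟩, h₃⟩ := (((hs.eventually h).and ht).and self_mem_nhdsWithin).exists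
  rw [e.right_inv h₂, add_sub_cancel_left, map_smul, map_smul] at h₁
  exact smul_right_injective ℂ h₃ h₁

/-- The derivative of an affine homeomorphism is constant along connected sets. -/
lemma IsAffine.exists_const {φ : Surface ≃ₜ Surface} (hφ : IsAffine φ) {g : ℂ → Surface}
    {D : Set ℂ} (hD : IsOpen D) (hD' : IsPreconnected D) (hne : D.Nonempty)
    (hg : ∀ z ∈ D, ContinuousAt g z) : ∃ A : ℂ ≃ₗ[ℝ] ℂ, ∀ z ∈ D, HasAffineDerivAt φ A (g z) := by
  obtain ⟨z₀, hz₀⟩ := hne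
  obtain ⟨A, hA⟩ := hφ (g z₀)
  -- The derivative is locally constant, so the points of `D` with derivative `A` and those with
  -- another derivative form two open sets. They are disjoint by uniqueness.
  have hopen : ∀ S : Set (ℂ ≃ₗ[ℝ] ℂ), IsOpen {z | z ∈ D ∧ ∃ B ∈ S, HasAffineDerivAt φ B (g z)} := by
    intro S
    rw [isOpen_iff_mem_nhds]
    rintro z ⟨hz, B, hB, h⟩
    filter_upwards [hD.mem_nhds hz, (hg z hz).eventually (h.eventually φ.continuous)] with w hw hw'
    exact ⟨hw, B, hB, hw'⟩
  have hsub := hD'.subset_left_of_subset_union (hopen {A}) (hopen {A}ᶜ) ?_ ?_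
    ⟨z₀, hz₀, hz₀, A, rfl, hA⟩
  · refine ⟨A, fun z hz => ?_⟩
    obtain ⟨-, B, rfl, h⟩ := hsub hz
    exact h
  · rw [Set.disjoint_left]
    rintro z ⟨-, B, rfl, h⟩ ⟨-, C, hC, h'⟩
    exact hC (h'.unique h)
  · intro z hz
    obtain ⟨B, hB⟩ := hφ (g z)
    by_cases h : B = A
    · exact Or.inl ⟨hz, B, h, hB⟩
    · exact Or.inr ⟨hz, B, h, hB⟩

/-- Composition of a translation with the inverse of an affine homeomorphism. -/
lemma IsTranslationOn.symm_comp {φ : Surface ≃ₜ Surface} {ι : ℂ → Surface} {D : Set ℂ}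
    (hι : IsTranslationOn ι D) {A : ℂ ≃ₗ[ℝ] ℂ}
    (hA : ∀ z ∈ D, HasAffineDerivAt φ A (φ.symm (ι z))) :
    IsTranslationOn (fun w => φ.symm (ι (A w))) (A ⁻¹' D) := by
  intro w hw
  obtain ⟨hc, ht⟩ := hι (A w) hw
  have hAc : Continuous A := LinearMap.continuous_of_finiteDimensional (A : ℂ →ₗ[ℝ] ℂ)
  have hιA : ContinuousAt (fun w => ι (A w)) w := ContinuousAt.comp (f := A) hc hAc.continuousAt
  have hψ : ContinuousAt (fun w => φ.symm (ι (A w))) w := φ.symm.continuous.continuousAt.comp hιA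
  refine ⟨hψ, fun e he hx => ?_⟩
  obtain ⟨e', he', hx'⟩ := exists_canonicalChart (ι (A w))
  have h := hA _ hw e he e' he' hx (by simpa using hx')
  filter_upwards [hψ.eventually h, hAc.continuousAt.eventually (ht e' he' hx')] with v h₁ h₂
  simp only [φ.apply_symm_apply] at h₁
  -- Precomposition with `A` compensates the linear part of `φ.symm`; injectivity of `A` then leaves
  -- a translation.
  have : A (e (φ.symm (ι (A v))) - e (φ.symm (ι (A w)))) = A (v - w) := by
    rw [map_sub A v w]
    exact add_left_cancel (h₁.symm.trans h₂)
  rw [← A.injective this]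
  ring

lemma re_apply (A : ℂ ≃ₗ[ℝ] ℂ) (z : ℂ) :
    (A z).re = (A 1).re * z.re + (A Complex.I).re * z.im := by
  have h : z = z.re • (1 : ℂ) + z.im • Complex.I := by
    apply Complex.ext <;> simp
  conv_lhs => rw [h, map_add, map_smul, map_smul]
  simp
  ring

lemma exists_halfSquare_subset (A : ℂ ≃ₗ[ℝ] ℂ) {ε : ℝ} (hε : 0 < ε) :
    ∃ r > 0, halfSquare (A 1).re (A Complex.I).re r ⊆
      A ⁻¹' ({z | 0 < z.re} ∩ Metric.ball 0 ε) := by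
  have hAc : Continuous A := LinearMap.continuous_of_finiteDimensional (A : ℂ →ₗ[ℝ] ℂ)
  obtain ⟨δ, hδ, hb⟩ := Metric.mem_nhds_iff.1 (hAc.continuousAt.preimage_mem_nhds
    (by simpa using Metric.ball_mem_nhds (0 : ℂ) hε : Metric.ball (0 : ℂ) ε ∈ 𝓝 (A 0)))
  refine ⟨δ / 2, by positivity, fun z hz => ⟨?_, hb ?_⟩⟩
  · have h : 0 < (A z).re := by rw [re_apply]; exact hz.1
    exact h
  · rw [mem_ball_zero_iff]
    linarith [Complex.norm_le_abs_re_add_abs_im z, hz.2.1, hz.2.2]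

end ArnouxYoccoz

/-! ### The half disc at `(0, 2/3)` and its preimage -/

open ArnouxYoccoz in
theorem lemmaL (φ : Surface ≃ₜ Surface) (hφ : IsAffine φ) (θ : ℙ ℝ ℂ) (hθ : θ ≠ vertical) :
    ¬ SendsDirection φ θ vertical := by
  intro hs
  obtain ⟨f, hf⟩ := exists_extension_proj
  let c : ℂ := ⟨0, 2 / 3⟩
  -- The radius 1/6 is the distance from the height 2/3 to the bottom 1/2 of the upper rectangle.
  let D : Set ℂ := {z | 0 < z.re} ∩ Metric.ball 0 (1 / 6)
  have hDo : IsOpen D := (isOpen_lt continuous_const Complex.continuous_re).inter Metric.isOpen_ball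
  have hDc : Convex ℝ D :=
    (by simpa using convex_pos 1 0 : Convex ℝ {z : ℂ | 0 < z.re}).inter (convex_ball 0 _)
  have hDi : ∀ z ∈ D, c + z ∈ polygonInterior := by
    rintro z ⟨hz, hz'⟩
    rw [mem_ball_zero_iff] at hz'
    have h₁ := abs_lt.1 ((Complex.abs_re_le_norm z).trans_lt hz')
    have h₂ := abs_lt.1 ((Complex.abs_im_le_norm z).trans_lt hz')
    replace hz : 0 < z.re := hz
    apply mem_upper <;> simp only [c, Complex.add_re, Complex.add_im] <;> linarith [h₁.2, h₂.1, h₂.2]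
  have hι : IsTranslationOn (fun z => f (c + z)) D := (isTranslationOn_extension hf c).mono hDi
  have hz₀ : (⟨1 / 12, 0⟩ : ℂ) ∈ D := by
    refine ⟨by norm_num, ?_⟩
    rw [mem_ball_zero_iff]
    refine (Complex.norm_le_abs_re_add_abs_im _).trans_lt ?_
    norm_num
  obtain ⟨A, hA⟩ := hφ.exists_const hDo hDc.isPreconnected ⟨_, hz₀⟩
    (g := fun z => φ.symm (f (c + z)))
    fun z hz => φ.symm.continuous.continuousAt.comp (hι z hz).1
  obtain ⟨r, hr, hrD⟩ := exists_halfSquare_subset A (by norm_num : (0 : ℝ) < 1 / 6)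
  have hψ := (hι.symm_comp hA).mono hrD
  have hdir := hs _ A (hA _ hz₀)
  induction θ using Projectivization.ind with | h v hv => ?_
  rw [Projectivization.map_mk, vertical, Projectivization.mk_eq_mk_iff'] at hdir
  obtain ⟨k, hk⟩ := hdir
  replace hk : A v = k • Complex.I := hk.symm
  have hvre : v.re ≠ 0 := by
    intro h
    refine hθ ((Projectivization.mk_eq_mk_iff' ℝ _ _ hv Complex.I_ne_zero).2 ⟨v.im, ?_⟩)
    apply Complex.ext <;> simp [h]
  have hk₀ : k ≠ 0 := by
    rintro rfl
    rw [zero_smul] at hk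
    exact hv ((map_eq_zero_iff A A.injective).1 hk)
  -- The boundary line of the pulled back half disc is the kernel of `z ↦ (A z).re`, and it contains
  -- `v` because `A v` is vertical.
  have hab : (A 1).re + (A Complex.I).re * (v.im / v.re) = 0 := by
    have h := re_apply A v
    rw [hk] at h
    simp only [Complex.smul_re, Complex.I_re, smul_zero] at h
    field_simp
    linarith
  have hb : (A Complex.I).re ≠ 0 := by
    intro hb
    rw [hb, zero_mul, add_zero] at hab
    obtain ⟨z, hz⟩ := A.surjective 1
    have h := re_apply A z
    rw [hab, hb, hz] at h
    simp at h
  have hray : ∀ s : ℝ, A ⟨s, s * (v.im / v.re)⟩ = ⟨0, s * (k / v.re)⟩ := by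
    intro s
    have h : (⟨s, s * (v.im / v.re)⟩ : ℂ) = (s / v.re) • v := by
      apply Complex.ext <;> simp <;> field_simp
    rw [h, map_smul, hk]
    apply Complex.ext <;> simp
    ring
  have hkv : k / v.re ≠ 0 := div_ne_zero hk₀ hvre
  -- The sign of `k / v.re` decides whether the right half of the line goes to the upper or the
  -- lower half of the diameter; removed endpoints accumulate on both. Some arbitrarily small `s`
  -- thus gives an endpoint at which the limit nevertheless exists.
  obtain ⟨s, hsing, ⟨x, hx⟩, hs₀, hs₁⟩ := ((frequently_notMem_polygon hkv).and_eventually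
    ((eventually_exists_tendsto hr hb hab hψ).and
      (eventually_small (div_pos (by norm_num : (0 : ℝ) < 1 / 6) (abs_pos.2 hkv))))).exists
  have hAc : Continuous A := LinearMap.continuous_of_finiteDimensional (A : ℂ →ₗ[ℝ] ℂ)
  have := neBot_nhdsWithin_pos (a := (A 1).re) (z := ⟨s, s * (v.im / v.re)⟩) hb
    (by simp only; linear_combination s * hab)
  have hball : A ⟨s, s * (v.im / v.re)⟩ ∈ Metric.ball (0 : ℂ) (1 / 6) := by
    rw [hray, mem_ball_zero_iff]
    refine (Complex.norm_le_abs_re_add_abs_im _).trans_lt ?_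
    rw [lt_div_iff₀ (abs_pos.2 hkv)] at hs₁
    simpa only [abs_zero, zero_add, abs_mul, abs_of_pos hs₀] using hs₁
  have hcA : Continuous fun w => c + A w := by fun_prop
  -- Applying `φ` to the limit `x` makes the projections of the points `c + A w` converge, while
  -- these points tend to the removed endpoint in the plane.
  have hlim := liesOver_of_tendsto (f := fun w => c + A w) ?_
    ((hcA.tendsto _).mono_left nhdsWithin_le_nhds) ((φ.continuous.tendsto x).comp hx)
  · refine hsing ?_
    convert hlim.mem using 1
    rw [hray]
    apply Complex.ext <;> simp [c]
  · filter_upwards [self_mem_nhdsWithin, nhdsWithin_le_nhds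
      (hAc.continuousAt.preimage_mem_nhds (Metric.isOpen_ball.mem_nhds hball))] with w hw hw'
    have hwD : A w ∈ D := ⟨by show 0 < (A w).re; rw [re_apply]; exact hw, hw'⟩
    simpa using hf _ (polygonInterior_subset (hDi _ hwD))
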